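/- Let $q\ge 3$, $\lambda\in[-\frac1{q-1},1]$, and let $T$ be either a regular tree in which every vertex has $d\in\mathbb{Z}_{\ge0}$ children, or a Galton–Watson tree with offspring distribution $\mathrm{Pois}(d)$, $d\ge 0$ real; let $b$ denote a random variable with the offspring distribution ($b=d$, resp. $b\sim\mathrm{Pois}(d)$). A $q$-ary input channel $M$ is a Markov kernel $x\mapsto M(\cdot|x)$ from $[q]$ to a measurable space. Let $P_\lambda(j|i)=\lambda\mathbf 1\{i=j\}+\frac{1-\lambda}q$ be the Potts channel on $[q]$. Let $M\circ P_\lambda$ be the channel that first applies $P_\lambda$ and then $M$; let $P\star Q$ be the channel that outputs the pair of conditionally independent outputs of $P$ and $Q$ on the same input, with $M^{\star 0}$ the trivial channel (one-point output) and $M^{\star (b+1)}=M^{\star b}\star M$; and let $\mathbb{E}_b N_b$ be the channel that draws $b$ independently of the input and outputs $b$ together with the output of $N_b$. The belief propagation operator is $$\mathrm{BP}(M)=\mathbb{E}_b\,(M\circ P_\lambda)^{\star b}.$$ A channel $P$ is a degradation of $Q$ if $P=R\circ Q$ for some channel (Markov kernel) $R$; two channels are equivalent if each is a degradation of the other, and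 a fixed point of $\mathrm{BP}$ is a channel $M$ such that $\mathrm{BP}(M)$ is equivalent to $M$. A channel is trivial if its output law does not depend on the input. A channel $P:[q]\to\mathcal Y$ is fully memoryless symmetric (FMS) if there is a group homomorphism $\iota$ from the symmetric group of $[q]$ to the group of measurable automorphisms of $\mathcal Y$ with $P(E|x)=P(\iota(\tau)E\,|\,\tau(x))$ for all $x\in[q]$, all permutations $\tau$ of $[q]$ and all measurable $E\subseteq\mathcal Y$. Channels $P_k$ converge weakly to $P$ if the laws, on the simplex $\mathcal P([q])$, of the posterior distribution of a uniform input given the output of $P_k$ converge weakly to the corresponding law for $P$. Proposition. If $d\lambda^2>1$, then $\mathrm{BP}$ has a fixed point $M$ that is non-trivial and is not equivalent to any FMS channel. Moreover, $M$ can be taken to be a weak limit of $\mathrm{BP}^k(U)$ as $k\to\infty$, where $U:[q]\to\{+,-\}$ is the channel that maps $1$ to $+$ and $2,\dots,q$ to $-$. -/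

import Mathlib

open MeasureTheory ProbabilityTheory Filter
open scoped Topology NNReal ENNReal ProbabilityTheory

universe u v

/-- An information channel with input alphabet `[q]` (modelled by `Fin q`): a measurable output
space together with a Markov kernel `x ↦ P(· | x)`. -/
structure Channel (q : ℕ) : Type (u + 1) where
  /-- the output alphabet -/
  Out : Type u
  [measurableSpaceOut : MeasurableSpace Out]
  /-- the transition kernel -/
  kernel : Kernel (Fin q) Out
  [isMarkovKernel : IsMarkovKernel kernel]

namespace Channel

attribute [instance] Channel.measurableSpaceOut Channel.isMarkovKernel

variable {q : ℕ}

/-- `P` is a degradation of `Q`: `P = R ∘ Q` for some channel `R` between the output alphabets. -/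
def Degradation (P : Channel.{u} q) (Q : Channel.{v} q) : Prop :=
  ∃ R : Kernel Q.Out P.Out, IsMarkovKernel R ∧ P.kernel = R ∘ₖ Q.kernel

/-- Two channels are equivalent if each is a degradation of the other. -/
def Equivalent (P : Channel.{u} q) (Q : Channel.{v} q) : Prop :=
  P.Degradation Q ∧ Q.Degradation P

/-- A channel is trivial if the law of its output does not depend on the input. -/
def IsTrivial (P : Channel.{u} q) : Prop :=
  ∀ i j : Fin q, P.kernel i = P.kernel j

/-- Fully memoryless symmetric channels: the symmetric group of the input alphabet acts by
measurable automorphisms on the output alphabet so that `P(E | x) = P(ι(τ) E | τ x)`. -/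
def IsFMS (P : Channel.{u} q) : Prop :=
  ∃ ι : Equiv.Perm (Fin q) →* Equiv.Perm P.Out,
    (∀ τ, Measurable (ι τ)) ∧
      ∀ (τ : Equiv.Perm (Fin q)) (x : Fin q) (E : Set P.Out), MeasurableSet E →
        P.kernel x E = P.kernel (τ x) (ι τ '' E)

/-- The channel with a one-point output alphabet. -/
noncomputable def trivialChannel (q : ℕ) : Channel.{u} q where
  Out := PUnit
  kernel := Kernel.const (Fin q) (Measure.dirac PUnit.unit)

/-- The channel `[q] → {+, -}` telling whether the input is the first letter of `[q]`
(which is `0 : Fin q`). -/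
noncomputable def indicatorChannel (q : ℕ) [NeZero q] : Channel.{0} q where
  Out := Bool
  kernel := Kernel.deterministic (fun i : Fin q => decide (i = 0)) Measurable.of_discrete

/-- Composition `P ∘ K`: the input first goes through `K : [q] → [q]`, then through `P`. -/
noncomputable def precomp (P : Channel.{u} q) (K : Kernel (Fin q) (Fin q)) [IsMarkovKernel K] :
    Channel.{u} q where
  Out := P.Out
  kernel := P.kernel ∘ₖ K

/-- The convolution `P ⋆ Q`: both channels act independently on the same input. -/
noncomputable def star (P Q : Channel.{u} q) : Channel.{u} q where
  Out := P.Out × Q.Out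
  kernel := P.kernel ×ₖ Q.kernel

/-- The convolution power `P^{⋆ b}`; the empty product is the trivial channel. -/
noncomputable def starPow (P : Channel.{u} q) : ℕ → Channel.{u} q
  | 0 => trivialChannel q
  | b + 1 => star (starPow P b) P

/-- The mixture `𝔼_b N_b`: a random index `b ~ β`, independent of the input, is drawn, and the
output is `b` together with the output of `N_b`. -/
noncomputable def mixture (β : Measure ℕ) [IsProbabilityMeasure β] (N : ℕ → Channel.{u} q) :
    Channel.{u} q where
  Out := Σ b : ℕ, (N b).Out
  kernel :=
    { toFun := fun i => β.bind fun b => ((N b).kernel i).map (Sigma.mk b)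
      measurable' := Measurable.of_discrete }
  isMarkovKernel := ⟨fun i => by
    have hmk : ∀ b, Measurable (fun y : (N b).Out => (⟨b, y⟩ : Σ b : ℕ, (N b).Out)) := by
      intro b s hs
      exact (MeasurableSpace.measurableSet_iInf.1 hs) b
    refine isProbabilityMeasure_bind (f := fun b => ((N b).kernel i).map (Sigma.mk b))
      Measurable.of_discrete.aemeasurable (Filter.Eventually.of_forall fun b => ?_)
    exact Measure.isProbabilityMeasure_map (hmk b).aemeasurable⟩

/-- The point of the simplex `𝒫([q])` given by the posterior law of a uniformly distributed input
when the output of the channel is `y`. -/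
noncomputable def posteriorPoint [NeZero q] (P : Channel.{u} q) (y : P.Out) :
    stdSimplex ℝ (Fin q) :=
  ⟨fun i => (posterior P.kernel (PMF.uniformOfFintype (Fin q)).toMeasure y).real {i},
    fun _ => measureReal_nonneg, by
      rw [sum_measureReal_singleton]
      simp⟩

theorem measurable_posteriorPoint [NeZero q] (P : Channel.{u} q) :
    Measurable P.posteriorPoint := by
  refine Measurable.subtype_mk (measurable_pi_lambda _ fun i => ?_)
  exact (Kernel.measurable_coe _ (measurableSet_singleton i)).ennreal_toReal

/-- The law, on `𝒫([q])`, of the posterior law of the input given the output, when the input is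
uniformly distributed. -/
noncomputable def posteriorLaw [NeZero q] (P : Channel.{u} q) :
    ProbabilityMeasure (stdSimplex ℝ (Fin q)) :=
  ⟨(P.kernel ∘ₘ (PMF.uniformOfFintype (Fin q)).toMeasure).map P.posteriorPoint,
    Measure.isProbabilityMeasure_map P.measurable_posteriorPoint.aemeasurable⟩

/-- Weak convergence of channels: weak convergence of the laws of their posteriors. -/
def ConvergesWeakly [NeZero q] (P : ℕ → Channel.{u} q) (P' : Channel.{v} q) : Prop :=
  Tendsto (fun k => (P k).posteriorLaw) atTop (𝓝 P'.posteriorLaw)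

end Channel

/-- The row `j ↦ λ 1{i = j} + (1 - λ) / q` of the Potts channel, for
`λ ∈ [-1/(q-1), 1]`. -/
noncomputable def pottsPMF {q : ℕ} [NeZero q] (lam : ℝ)
    (hlam : lam ∈ Set.Icc (-1 / ((q : ℝ) - 1)) 1) (i : Fin q) : PMF (Fin q) :=
  PMF.ofFintype (fun j => ENNReal.ofReal (lam * (if i = j then 1 else 0) + (1 - lam) / q)) (by
    have hq0 : 0 < q := Nat.pos_of_ne_zero (NeZero.ne q)
    have hq : (0 : ℝ) < q := by exact_mod_cast hq0
    rw [← ENNReal.ofReal_sum_of_nonneg]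
    · rw [Finset.sum_add_distrib, ← Finset.mul_sum]
      simp
      field_simp
      ring
    · intro j _
      obtain ⟨h1, h2⟩ := hlam
      have h3 : 0 ≤ (1 - lam) / q := div_nonneg (by linarith) hq.le
      split_ifs with h
      · have h4 : lam * 1 + (1 - lam) / q = (lam * (q - 1) + 1) / q := by
          field_simp
          ring
        rw [h4]
        refine div_nonneg ?_ hq.le
        rcases Nat.lt_or_ge 1 q with h5 | h5
        · have h6 : (0 : ℝ) < q - 1 := by
            have : (1 : ℝ) < q := by exact_mod_cast h5
            linarith
          rw [div_le_iff₀ h6] at h1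
          linarith
        · have h6 : q = 1 := by omega
          simp [h6]
      · simpa using h3)

/-- The Potts channel `P_λ(j | i) = λ 1{i = j} + (1 - λ) / q` as a Markov kernel. -/
noncomputable def pottsKernel {q : ℕ} [NeZero q] (lam : ℝ)
    (hlam : lam ∈ Set.Icc (-1 / ((q : ℝ) - 1)) 1) : Kernel (Fin q) (Fin q) where
  toFun i := (pottsPMF lam hlam i).toMeasure
  measurable' := Measurable.of_discrete

instance {q : ℕ} [NeZero q] (lam : ℝ) (hlam : lam ∈ Set.Icc (-1 / ((q : ℝ) - 1)) 1) :
    IsMarkovKernel (pottsKernel lam hlam) :=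
  ⟨fun i => PMF.toMeasure.isProbabilityMeasure (pottsPMF lam hlam i)⟩

/-- The two kinds of trees: the regular tree with `d` children per vertex, and the Galton-Watson
tree with offspring distribution `Poisson(d)`. -/
inductive TreeModel : Type
  | regular (d : ℕ) : TreeModel
  | poisson (d : ℝ≥0) : TreeModel

namespace TreeModel

/-- The expected offspring `d`. -/
noncomputable def meanOffspring : TreeModel → ℝ
  | regular d => d
  | poisson d => d

/-- The branching number distribution. -/
noncomputable def offspringLaw : TreeModel → Measure ℕ
  | regular d => Measure.dirac d
  | poisson d => poissonMeasure d

instance (T : TreeModel) : IsProbabilityMeasure T.offspringLaw := by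
  cases T <;> simp only [offspringLaw] <;> infer_instance

end TreeModel

/-- The belief propagation operator `BP(M) = 𝔼_b (M ∘ P_λ)^{⋆ b}`. -/
noncomputable def BP {q : ℕ} [NeZero q] (T : TreeModel) (lam : ℝ)
    (hlam : lam ∈ Set.Icc (-1 / ((q : ℝ) - 1)) 1) (M : Channel.{u} q) : Channel.{u} q :=
  Channel.mixture T.offspringLaw fun b => (M.precomp (pottsKernel lam hlam)).starPow b

/-!
The statement is about the posterior laws of channels, which are probability measures on the compact
simplex. The exponentials of linear forms are convex and span a point-separating algebra, so their
integrals determine such a measure (`ext_of_integral_expLin`) and detect weak convergence.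

Whether the letter after the Potts channel is `0` depends on the letter before it only through
whether that one is `0`. Hence `BP(U)` is a degradation of `U`, and as `BP` preserves degradation,
the channels `BP^k(U)` get more and more degraded (`degradation_bp_iterate_succ`). By data
processing the integrals of exponentials of linear forms against their posterior laws decrease, so
these laws converge weakly to some `μ` (`exists_tendsto_posteriorLaw`). The limit `M` is the channel
that outputs a point of the simplex and has posterior law `μ` (`ofPosteriorLaw`).

On posterior laws each of the operations that make up `BP` is weakly continuous: the posterior law
of the result is obtained by integrating the perspective `v ↦ |v| φ(v / |v|)` of the test function
`φ`, which is continuous on the orthant (`ConvergesWeakly.bp`). So `BP(M)` and `M` have the same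
posterior law, and this makes them equivalent, because over standard Borel spaces the output of a
channel can be resampled from its posterior (`degradation_of_posteriorLaw_eq`).

The limit is non-trivial by the Kesten–Stigum second moment argument. For `f = 1_{0} - 1/q`, which
is an eigenvector of the Potts channel, each `BP^k(U)` has an estimator of `f` that is unbiased and
has a second moment bounded uniformly in `k`; the step from `k` to `k + 1` adds up the estimators
of the children and divides by `d λ` (`HasEstimator.bp`). By Cauchy–Schwarz the posterior
probabilities of `0` and `1` stay apart in mean square (`HasEstimator.one_le`), and this bound
passes to the limit.

Finally `BP^k(U)`, a degradation of `U`, does not distinguish the letters `1` and `2`, so neither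
does `M`. If `M` were equivalent to a fully memoryless symmetric channel, that channel would not
distinguish `1` from `2` either, so by double transitivity of the symmetric group it would be
trivial (`IsFMS.isTrivial`), and so would be `M`.
-/

universe w

/-! ### The perspective of a function on the simplex -/

/-- The positively homogeneous extension `v ↦ |v| φ(v / |v|)`, with `|v| = ∑ i, v i`, of a function
`φ` on the simplex to the nonnegative orthant. It vanishes where `|v| = 0`. -/
noncomputable def perspective {ι : Type*} [Fintype ι] (φ : (ι → ℝ) → ℝ) (v : ι → ℝ) : ℝ :=
  (∑ i, v i) * φ ((∑ i, v i)⁻¹ • v)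

section perspective

variable {ι : Type*} [Fintype ι] {φ : (ι → ℝ) → ℝ}

theorem perspective_smul (φ : (ι → ℝ) → ℝ) (c : ℝ) (v : ι → ℝ) :
    perspective φ (c • v) = c * perspective φ v := by
  unfold perspective
  rcases eq_or_ne c 0 with rfl | hc
  · simp
  · have h : ∑ i, (c • v) i = c * ∑ i, v i := by simp [Finset.mul_sum]
    rw [h, smul_smul, mul_inv, mul_assoc, mul_right_comm, inv_mul_cancel₀ hc, one_mul]

theorem perspective_coe_stdSimplex (φ : (ι → ℝ) → ℝ) (p : stdSimplex ℝ ι) :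
    perspective φ p = φ p := by
  have h : ∑ i, (p : ι → ℝ) i = 1 := p.2.2
  rw [perspective, h]
  simp

theorem measurable_perspective (hφ : Measurable φ) : Measurable (perspective φ) := by
  unfold perspective
  fun_prop

theorem inv_sum_smul_mem_stdSimplex {v : ι → ℝ} (hv : ∀ i, 0 ≤ v i) (h : ∑ i, v i ≠ 0) :
    (∑ i, v i)⁻¹ • v ∈ stdSimplex ℝ ι := by
  refine ⟨fun i => mul_nonneg (inv_nonneg.2 (Finset.sum_nonneg fun i _ => hv i)) (hv i), ?_⟩
  simp only [Pi.smul_apply, smul_eq_mul, ← Finset.mul_sum]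
  exact inv_mul_cancel₀ h

/-- The perspective is continuous also at the vectors of total mass zero, since `φ` is bounded on
the simplex. -/
theorem continuousOn_perspective (hφ : Continuous φ) :
    ContinuousOn (perspective φ) {v | ∀ i, 0 ≤ v i} := by
  intro v hv
  have hs : Continuous fun v : ι → ℝ => ∑ i, v i := by fun_prop
  by_cases h : ∑ i, v i = 0
  · -- near a vector of total mass zero, `|perspective φ w| ≤ C * ∑ i, w i`
    obtain ⟨C, hC⟩ := (isCompact_stdSimplex ℝ ι).exists_bound_of_continuousOn hφ.continuousOn
    have hbound : ∀ w ∈ {v : ι → ℝ | ∀ i, 0 ≤ v i}, |perspective φ w| ≤ (∑ i, w i) * C := by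
      intro w hw
      have hw0 : 0 ≤ ∑ i, w i := Finset.sum_nonneg fun i _ => hw i
      by_cases h' : ∑ i, w i = 0
      · simp [perspective, h']
      · rw [perspective, abs_mul, abs_of_nonneg hw0]
        exact mul_le_mul_of_nonneg_left (hC _ (inv_sum_smul_mem_stdSimplex hw h')) hw0
    have h0 : perspective φ v = 0 := by simp [perspective, h]
    rw [ContinuousWithinAt, h0]
    refine squeeze_zero_norm' (eventually_nhdsWithin_of_forall hbound) ?_
    have : Tendsto (fun w : ι → ℝ => (∑ i, w i) * C) (𝓝 v) (𝓝 ((∑ i, v i) * C)) :=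
      (hs.mul continuous_const).tendsto v
    rw [h, zero_mul] at this
    exact this.mono_left nhdsWithin_le_nhds
  · refine ContinuousAt.continuousWithinAt ?_
    have h1 : ContinuousAt (fun w : ι → ℝ => (∑ i, w i)⁻¹ • w) v :=
      (hs.continuousAt.inv₀ h).smul continuousAt_id
    exact hs.continuousAt.mul (hφ.continuousAt.comp h1)

end perspective

/-! ### Exponential test functions on the simplex -/

/-- The exponential of the linear form with coefficients `ℓ`. -/
noncomputable def expLin {ι : Type*} [Fintype ι] (ℓ p : ι → ℝ) : ℝ :=
  Real.exp (∑ i, ℓ i * p i)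

section expLin

variable {ι : Type*} [Fintype ι]

@[fun_prop]
theorem continuous_expLin (ℓ : ι → ℝ) : Continuous (expLin ℓ) := by
  unfold expLin
  fun_prop

/-- The exponential of a linear form as a bounded continuous function on the simplex. -/
noncomputable def expLinBCF (ℓ : ι → ℝ) : BoundedContinuousFunction (stdSimplex ℝ ι) ℝ :=
  BoundedContinuousFunction.mkOfCompact
    ⟨fun p => expLin ℓ p, (continuous_expLin ℓ).comp continuous_subtype_val⟩

/-- Finite measures on the simplex are determined by the integrals of exponentials of linear forms,
since these span an algebra that separates points. -/
theorem ext_of_integral_expLin {μ ν : Measure (stdSimplex ℝ ι)} [IsFiniteMeasure μ]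
    [IsFiniteMeasure ν] (h : ∀ ℓ : ι → ℝ, ∫ p, expLin ℓ p ∂μ = ∫ p, expLin ℓ p ∂ν) : μ = ν := by
  classical
  set A : StarSubalgebra ℝ (BoundedContinuousFunction (stdSimplex ℝ ι) ℝ) :=
    StarAlgebra.adjoin ℝ (Set.range expLinBCF) with hA
  have hmul : (Submonoid.closure (Set.range (expLinBCF (ι := ι))) :
      Set (BoundedContinuousFunction (stdSimplex ℝ ι) ℝ)) = Set.range expLinBCF := by
    refine subset_antisymm (fun f hf => ?_) Submonoid.subset_closure
    induction hf using Submonoid.closure_induction with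
    | mem x hx => exact hx
    | one => exact ⟨0, by ext p; simp [expLinBCF, expLin]⟩
    | mul x y _ _ hx hy =>
      obtain ⟨a, rfl⟩ := hx
      obtain ⟨b, rfl⟩ := hy
      refine ⟨a + b, ?_⟩
      ext p
      simp [expLinBCF, expLin, ← Real.exp_add, add_mul, Finset.sum_add_distrib]
  have hstar : star (Set.range (expLinBCF (ι := ι))) = Set.range expLinBCF := by
    have : ∀ f : BoundedContinuousFunction (stdSimplex ℝ ι) ℝ, star f = f := fun f => by
      ext p; simp
    ext f
    simp [Set.mem_star, this]
  refine ext_of_forall_mem_subalgebra_integral_eq_of_polish (𝕜 := ℝ) (A := A) ?_ ?_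
  · intro p p' hpp'
    obtain ⟨i, hi⟩ : ∃ i, (p : ι → ℝ) i ≠ (p' : ι → ℝ) i := by
      by_contra! hcon
      exact hpp' (Subtype.ext (funext hcon))
    refine ⟨_, ⟨_, ⟨expLinBCF (Pi.single i 1),
      StarAlgebra.subset_adjoin ℝ _ ⟨_, rfl⟩, rfl⟩, rfl⟩, ?_⟩
    simpa [expLinBCF, expLin, Pi.single_apply] using hi
  · intro g hg
    have hg' : g ∈ Submodule.span ℝ (Set.range (expLinBCF (ι := ι))) := by
      have : g ∈ Subalgebra.toSubmodule A.toSubalgebra := hg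
      rw [hA, StarAlgebra.adjoin_eq_span, hstar, Set.union_self, hmul] at this
      exact this
    induction hg' using Submodule.span_induction with
    | mem x hx =>
      obtain ⟨ℓ, rfl⟩ := hx
      exact h ℓ
    | zero => simp
    | add x y hx hy hx' hy' =>
      have e : ∀ z ∈ Submodule.span ℝ (Set.range (expLinBCF (ι := ι))), z ∈ A := fun z hz => by
        change z ∈ Subalgebra.toSubmodule A.toSubalgebra
        rw [hA, StarAlgebra.adjoin_eq_span, hstar, Set.union_self, hmul]
        exact hz
      simp only [BoundedContinuousFunction.coe_add, Pi.add_apply]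
      rw [integral_add (x.integrable μ) (y.integrable μ),
        integral_add (x.integrable ν) (y.integrable ν), hx' (e x hx), hy' (e y hy)]
    | smul a x hx hx' =>
      have e : ∀ z ∈ Submodule.span ℝ (Set.range (expLinBCF (ι := ι))), z ∈ A := fun z hz => by
        change z ∈ Subalgebra.toSubmodule A.toSubalgebra
        rw [hA, StarAlgebra.adjoin_eq_span, hstar, Set.union_self, hmul]
        exact hz
      simp only [BoundedContinuousFunction.coe_smul]
      rw [integral_smul, integral_smul, hx' (e x hx)]

theorem tendsto_integral_of_tendsto_probabilityMeasure {γ X : Type*} [TopologicalSpace X]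
    [CompactSpace X] [MeasurableSpace X] [OpensMeasurableSpace X] {F : Filter γ}
    {μ : γ → ProbabilityMeasure X} {ν : ProbabilityMeasure X} (h : Tendsto μ F (𝓝 ν))
    {φ : X → ℝ} (hφ : Continuous φ) :
    Tendsto (fun k => ∫ p, φ p ∂(μ k : Measure X)) F (𝓝 (∫ p, φ p ∂(ν : Measure X))) :=
  ProbabilityMeasure.tendsto_iff_forall_integral_tendsto.1 h
    (BoundedContinuousFunction.mkOfCompact ⟨φ, hφ⟩)

theorem tendsto_integral_expLin {γ : Type*} {F : Filter γ}
    {μ : γ → ProbabilityMeasure (stdSimplex ℝ ι)} {ν : ProbabilityMeasure (stdSimplex ℝ ι)}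
    (h : Tendsto μ F (𝓝 ν)) (ℓ : ι → ℝ) :
    Tendsto (fun k => ∫ p, expLin ℓ p ∂(μ k : Measure (stdSimplex ℝ ι))) F
      (𝓝 (∫ p, expLin ℓ p ∂(ν : Measure (stdSimplex ℝ ι)))) :=
  tendsto_integral_of_tendsto_probabilityMeasure h
    ((continuous_expLin ℓ).comp continuous_subtype_val)

/-- By compactness of the space of probability measures on the simplex, integrals of exponentials
of linear forms detect weak convergence. -/
theorem tendsto_of_tendsto_integral_expLin {γ : Type*} {F : Filter γ}
    {μ : γ → ProbabilityMeasure (stdSimplex ℝ ι)} {ν : ProbabilityMeasure (stdSimplex ℝ ι)}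
    (h : ∀ ℓ : ι → ℝ, Tendsto (fun k => ∫ p, expLin ℓ p ∂(μ k : Measure (stdSimplex ℝ ι))) F
      (𝓝 (∫ p, expLin ℓ p ∂(ν : Measure (stdSimplex ℝ ι))))) :
    Tendsto μ F (𝓝 ν) := by
  refine tendsto_nhds_of_unique_mapClusterPt fun ν' hν' => ?_
  obtain ⟨U, hU, hU'⟩ := mapClusterPt_iff_ultrafilter.1 hν'
  have hν : (ν' : Measure (stdSimplex ℝ ι)) = ν := ext_of_integral_expLin fun ℓ =>
    tendsto_nhds_unique (tendsto_integral_expLin hU' ℓ) ((h ℓ).mono_left hU)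
  exact Subtype.ext hν

/-- On the compact simplex, convergence of the integrals of all exponentials of linear forms is
enough for a sequence of probability measures to have a weak limit. -/
theorem exists_tendsto_of_tendsto_integral_expLin
    {μ : ℕ → ProbabilityMeasure (stdSimplex ℝ ι)}
    (h : ∀ ℓ : ι → ℝ, ∃ a, Tendsto
      (fun k => ∫ p, expLin ℓ p ∂(μ k : Measure (stdSimplex ℝ ι))) atTop (𝓝 a)) :
    ∃ ν, Tendsto μ atTop (𝓝 ν) := by
  obtain ⟨ν, -, hν⟩ := isCompact_univ.exists_mapClusterPt (f := atTop) (u := μ) (by simp)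
  refine ⟨ν, tendsto_of_tendsto_integral_expLin fun ℓ => ?_⟩
  obtain ⟨a, ha⟩ := h ℓ
  obtain ⟨U, hU, hU'⟩ := mapClusterPt_iff_ultrafilter.1 hν
  rwa [tendsto_nhds_unique (tendsto_integral_expLin hU' ℓ) (ha.mono_left hU)]

end expLin

namespace Channel

variable {q : ℕ} [NeZero q]

/-! ### Posterior densities -/

/-- The law of the output of the channel when the input is uniformly distributed. -/
noncomputable def marginal (P : Channel.{u} q) : Measure P.Out :=
  P.kernel ∘ₘ (PMF.uniformOfFintype (Fin q)).toMeasure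

instance (P : Channel.{u} q) : IsProbabilityMeasure P.marginal := by
  unfold marginal; infer_instance

theorem marginal_eq (P : Channel.{u} q) :
    P.marginal = (q : ℝ≥0∞)⁻¹ • ∑ i, P.kernel i := by
  rw [marginal, Measure.comp_eq_sum_of_countable, Measure.sum_fintype, Finset.smul_sum]
  refine Finset.sum_congr rfl fun i _ => ?_
  rw [PMF.toMeasure_apply_singleton _ _ (measurableSet_singleton i)]
  simp

theorem posteriorLaw_eq_map (P : Channel.{u} q) :
    (P.posteriorLaw : Measure (stdSimplex ℝ (Fin q))) = P.marginal.map P.posteriorPoint := rfl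

theorem integral_posteriorLaw (P : Channel.{u} q) {φ : stdSimplex ℝ (Fin q) → ℝ}
    (hφ : Measurable φ) :
    ∫ p, φ p ∂(P.posteriorLaw : Measure (stdSimplex ℝ (Fin q))) =
      ∫ y, φ (P.posteriorPoint y) ∂P.marginal := by
  rw [posteriorLaw_eq_map]
  exact integral_map P.measurable_posteriorPoint.aemeasurable hφ.aestronglyMeasurable

@[fun_prop]
theorem measurable_coe_posteriorPoint (P : Channel.{u} q) :
    Measurable fun y => (P.posteriorPoint y : Fin q → ℝ) :=
  measurable_subtype_coe.comp P.measurable_posteriorPoint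

@[fun_prop]
theorem measurable_posteriorPoint_apply (P : Channel.{u} q) (i : Fin q) :
    Measurable fun y => (P.posteriorPoint y : Fin q → ℝ) i :=
  (measurable_pi_apply i).comp P.measurable_coe_posteriorPoint

/-- Bayes' formula: `q` times the posterior probability of the input `i` is the density of
`P(· | i)` with respect to the marginal law of the output. -/
theorem kernel_eq_withDensity (P : Channel.{u} q) (i : Fin q) :
    P.kernel i = P.marginal.withDensity
      fun y => ENNReal.ofReal (q * (P.posteriorPoint y : Fin q → ℝ) i) := by
  have hq : (q : ℝ≥0∞) ≠ 0 := by exact_mod_cast NeZero.ne q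
  ext E hE
  have h := congrArg (fun m => m (E ×ˢ {i})) (compProd_posterior_eq_map_swap (κ := P.kernel)
    (μ := (PMF.uniformOfFintype (Fin q)).toMeasure))
  have hswap : Prod.swap ⁻¹' (E ×ˢ {i}) = ({i} : Set (Fin q)) ×ˢ E := by
    ext ⟨a, b⟩; simp
  rw [Measure.compProd_apply_prod hE (measurableSet_singleton i),
    Measure.map_apply measurable_swap (hE.prod (measurableSet_singleton i)), hswap,
    Measure.compProd_apply_prod (measurableSet_singleton i) hE, lintegral_singleton,
    PMF.toMeasure_apply_singleton _ _ (measurableSet_singleton i)] at h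
  rw [withDensity_apply _ hE]
  have h1 : ∀ y, ENNReal.ofReal (q * (P.posteriorPoint y : Fin q → ℝ) i) =
      q * posterior P.kernel (PMF.uniformOfFintype (Fin q)).toMeasure y {i} := by
    intro y
    rw [ENNReal.ofReal_mul (by positivity), ENNReal.ofReal_natCast]
    congr 1
    exact ENNReal.ofReal_toReal (measure_ne_top _ _)
  simp_rw [h1]
  rw [lintegral_const_mul _ (Kernel.measurable_coe _ (measurableSet_singleton i)), marginal, h]
  simp only [PMF.uniformOfFintype_apply, Fintype.card_fin]
  rw [mul_comm (P.kernel i E), ← mul_assoc, ENNReal.mul_inv_cancel hq (ENNReal.natCast_ne_top q),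
    one_mul]

theorem integral_kernel (P : Channel.{u} q) (i : Fin q) (f : P.Out → ℝ) :
    ∫ y, f y ∂P.kernel i =
      ∫ y, q * (P.posteriorPoint y : Fin q → ℝ) i * f y ∂P.marginal := by
  rw [kernel_eq_withDensity, integral_withDensity_eq_integral_toReal_smul (by fun_prop)
    (Eventually.of_forall fun _ => ENNReal.ofReal_lt_top)]
  refine integral_congr_ae (Eventually.of_forall fun y => ?_)
  have : 0 ≤ (P.posteriorPoint y : Fin q → ℝ) i := (P.posteriorPoint y).2.1 i
  simp only [smul_eq_mul]
  rw [ENNReal.toReal_ofReal (by positivity)]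

/-- If the channel has densities `g y i` with respect to some reference measure, then its posterior
is the normalization of `g`. -/
theorem integral_posteriorLaw_of_withDensity (P : Channel.{u} q) {ρ : Measure P.Out}
    {g : P.Out → Fin q → ℝ} (hg : Measurable g) (hg0 : ∀ y i, 0 ≤ g y i)
    (hP : ∀ i, P.kernel i = ρ.withDensity fun y => ENNReal.ofReal (g y i))
    {φ : (Fin q → ℝ) → ℝ} (hφ : Measurable φ) :
    ∫ p, φ p ∂(P.posteriorLaw : Measure (stdSimplex ℝ (Fin q))) =
      (q : ℝ)⁻¹ * ∫ y, perspective φ (g y) ∂ρ := by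
  have hq : (0 : ℝ) < q := by exact_mod_cast Nat.pos_of_ne_zero (NeZero.ne q)
  have hgi : ∀ i, Measurable fun y => g y i := fun i => (measurable_pi_apply i).comp hg
  have hs0 : ∀ y, 0 ≤ ∑ i, g y i := fun y => Finset.sum_nonneg fun i _ => hg0 y i
  have hm : P.marginal = ρ.withDensity fun y => ENNReal.ofReal ((q : ℝ)⁻¹ * ∑ i, g y i) := by
    ext E hE
    rw [marginal_eq, withDensity_apply _ hE, Measure.smul_apply, Measure.finsetSum_apply,
      smul_eq_mul]
    simp_rw [hP, withDensity_apply _ hE]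
    rw [← lintegral_finsetSum _ (fun i _ => (hgi i).ennreal_ofReal), ← lintegral_const_mul _
      (Finset.measurable_fun_sum _ fun i _ => (hgi i).ennreal_ofReal)]
    refine lintegral_congr fun y => ?_
    rw [ENNReal.ofReal_mul (by positivity), ENNReal.ofReal_inv_of_pos hq, ENNReal.ofReal_natCast,
      ENNReal.ofReal_sum_of_nonneg fun i _ => hg0 y i]
  -- both densities of `P(· | i)` with respect to `ρ` agree: `g i` and `(∑ j, g j) * π i`
  have hae : ∀ᵐ y ∂ρ, ∀ i, g y i = (∑ j, g y j) * (P.posteriorPoint y : Fin q → ℝ) i := by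
    rw [ae_all_iff]
    intro i
    have h1 : ρ.withDensity (fun y => ENNReal.ofReal (g y i)) = ρ.withDensity
        ((fun y => ENNReal.ofReal ((q : ℝ)⁻¹ * ∑ i, g y i)) *
          fun y => ENNReal.ofReal (q * (P.posteriorPoint y : Fin q → ℝ) i)) := by
      rw [withDensity_mul _ (by fun_prop) (by fun_prop), ← hm, ← kernel_eq_withDensity, hP]
    have hfin : ∫⁻ y, ENNReal.ofReal (g y i) ∂ρ ≠ ∞ := by
      rw [← setLIntegral_univ, ← withDensity_apply _ MeasurableSet.univ, ← hP]
      exact measure_ne_top _ _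
    have h2 := (withDensity_eq_iff (by fun_prop) (by fun_prop) hfin).1 h1
    filter_upwards [h2] with y hy
    have hp : 0 ≤ (P.posteriorPoint y : Fin q → ℝ) i := (P.posteriorPoint y).2.1 i
    have hsy := hs0 y
    rw [Pi.mul_apply, ← ENNReal.ofReal_mul (by positivity),
      ENNReal.ofReal_eq_ofReal_iff (hg0 y i) (by positivity)] at hy
    rw [hy]
    field_simp
  rw [integral_posteriorLaw P (φ := fun p => φ p) (hφ.comp measurable_subtype_coe), hm,
    integral_withDensity_eq_integral_toReal_smul (by fun_prop)
      (Eventually.of_forall fun _ => ENNReal.ofReal_lt_top), ← integral_const_mul]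
  refine integral_congr_ae ?_
  filter_upwards [hae] with y hy
  have hsy := hs0 y
  rw [ENNReal.toReal_ofReal (by positivity), smul_eq_mul, perspective, mul_assoc]
  rcases eq_or_ne (∑ i, g y i) 0 with h0 | h0
  · simp [h0]
  · have : (∑ i, g y i)⁻¹ • g y = P.posteriorPoint y := by
      ext i
      rw [Pi.smul_apply, hy i, smul_eq_mul, ← mul_assoc, inv_mul_cancel₀ h0, one_mul]
    rw [this]

end Channel

/-! ### Measurability on disjoint unions -/

theorem measurable_sigmaMk {ι : Type*} {α : ι → Type*} [∀ b, MeasurableSpace (α b)] (b : ι) :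
    Measurable (Sigma.mk b : α b → Σ b, α b) := fun _ hs =>
  (MeasurableSpace.measurableSet_iInf.1 hs) b

theorem measurableSet_sigma_iff {ι : Type*} {α : ι → Type*} [∀ b, MeasurableSpace (α b)]
    {s : Set (Σ b, α b)} : MeasurableSet s ↔ ∀ b, MeasurableSet (Sigma.mk b ⁻¹' s) :=
  MeasurableSpace.measurableSet_iInf

theorem measurable_sigma_iff {ι : Type*} {α : ι → Type*} [∀ b, MeasurableSpace (α b)] {β : Type*}
    [MeasurableSpace β] {f : (Σ b, α b) → β} :
    Measurable f ↔ ∀ b, Measurable fun y => f ⟨b, y⟩ :=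
  ⟨fun hf b => hf.comp (measurable_sigmaMk b),
    fun hf _ hs => measurableSet_sigma_iff.2 fun b => hf b hs⟩

theorem integral_measure_comp {α β : Type*} {mα : MeasurableSpace α} {mβ : MeasurableSpace β}
    {μ : Measure α} {κ : Kernel α β} {f : β → ℝ} (hf : Integrable f (κ ∘ₘ μ)) :
    ∫ y, f y ∂(κ ∘ₘ μ) = ∫ x, ∫ y, f y ∂κ x ∂μ := by
  rw [Measure.comp_eq_comp_const_apply] at hf ⊢
  rw [Kernel.integral_comp hf, Kernel.const_apply]

namespace Channel

variable {q : ℕ} [NeZero q]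

/-! ### Continuity of the belief propagation operator -/

theorem star_kernel_apply {n : ℕ} (P Q : Channel.{u} n) (i : Fin n) :
    (P.star Q).kernel i = (P.kernel i).prod (Q.kernel i) :=
  Kernel.prod_apply _ _ _

/-- The posterior law of a convolution depends only on the posterior laws of the factors: the
posterior given both outputs is the normalized product of the two posteriors. -/
theorem integral_posteriorLaw_star (P Q : Channel.{u} q) {φ : (Fin q → ℝ) → ℝ}
    (hφ : Measurable φ) :
    ∫ p, φ p ∂((P.star Q).posteriorLaw : Measure (stdSimplex ℝ (Fin q))) =
      (q : ℝ)⁻¹ * ∫ z : stdSimplex ℝ (Fin q) × stdSimplex ℝ (Fin q),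
        perspective φ (fun i => q * (z.1 : Fin q → ℝ) i * (q * (z.2 : Fin q → ℝ) i))
        ∂(P.posteriorLaw.prod Q.posteriorLaw : Measure _) := by
  rw [integral_posteriorLaw_of_withDensity (P.star Q) (ρ := P.marginal.prod Q.marginal)
    (g := fun y i => q * (P.posteriorPoint y.1 : Fin q → ℝ) i *
      (q * (Q.posteriorPoint y.2 : Fin q → ℝ) i)) ?_ ?_ ?_ hφ]
  · congr 1
    rw [ProbabilityMeasure.toMeasure_prod, posteriorLaw_eq_map, posteriorLaw_eq_map,
      Measure.map_prod_map _ _ P.measurable_posteriorPoint Q.measurable_posteriorPoint,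
      integral_map]
    · rfl
    · exact (P.measurable_posteriorPoint.prodMap Q.measurable_posteriorPoint).aemeasurable
    · refine ((measurable_perspective hφ).comp
        (measurable_pi_lambda _ fun i => ?_)).aestronglyMeasurable
      have h : Measurable fun p : stdSimplex ℝ (Fin q) => (p : Fin q → ℝ) i :=
        (measurable_pi_apply i).comp measurable_subtype_coe
      exact ((h.comp measurable_fst).const_mul _).mul ((h.comp measurable_snd).const_mul _)
  · refine measurable_pi_lambda _ fun i => ?_
    exact (((P.measurable_posteriorPoint_apply i).comp measurable_fst).const_mul _).mul
      (((Q.measurable_posteriorPoint_apply i).comp measurable_snd).const_mul _)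
  · intro y i
    have h1 := (P.posteriorPoint y.1).2.1 i
    have h2 := (Q.posteriorPoint y.2).2.1 i
    positivity
  · intro i
    rw [star_kernel_apply, kernel_eq_withDensity P, kernel_eq_withDensity Q, prod_withDensity
      (by fun_prop) (by fun_prop)]
    congr 1
    ext y
    have h1 : 0 ≤ q * (P.posteriorPoint y.1 : Fin q → ℝ) i :=
      mul_nonneg (by positivity) ((P.posteriorPoint y.1).2.1 i)
    rw [ENNReal.ofReal_mul h1]

theorem ConvergesWeakly.star {P Q : ℕ → Channel.{u} q} {P' Q' : Channel.{v} q}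
    (hP : ConvergesWeakly P P') (hQ : ConvergesWeakly Q Q') :
    ConvergesWeakly (fun k => (P k).star (Q k)) (P'.star Q') := by
  refine tendsto_of_tendsto_integral_expLin fun ℓ => ?_
  simp_rw [integral_posteriorLaw_star _ _ (continuous_expLin ℓ).measurable]
  refine Tendsto.const_mul _ ?_
  have h := (ProbabilityMeasure.continuous_prod.tendsto _).comp (hP.prodMk_nhds hQ)
  refine tendsto_integral_of_tendsto_probabilityMeasure h ?_
  refine (continuousOn_perspective (continuous_expLin ℓ)).comp_continuous ?_ ?_
  · have h : ∀ i, Continuous fun p : stdSimplex ℝ (Fin q) => (p : Fin q → ℝ) i := fun i =>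
      (continuous_apply i).comp continuous_subtype_val
    exact continuous_pi fun i => (((h i).comp continuous_fst).const_mul _).mul
      (((h i).comp continuous_snd).const_mul _)
  · intro z i
    have h1 := z.1.2.1 i
    have h2 := z.2.2.1 i
    positivity

theorem ConvergesWeakly.starPow {P : ℕ → Channel.{u} q} {P' : Channel.{u} q}
    (hP : ConvergesWeakly P P') (b : ℕ) :
    ConvergesWeakly (fun k => (P k).starPow b) (P'.starPow b) := by
  induction b with
  | zero => exact tendsto_const_nhds
  | succ b ih => exact ih.star hP

theorem precomp_kernel_apply {n : ℕ} (P : Channel.{u} n) (K : Kernel (Fin n) (Fin n))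
    [IsMarkovKernel K] (i : Fin n) : (P.precomp K).kernel i = ∑ j, K i {j} • P.kernel j := by
  change (P.kernel ∘ₖ K) i = _
  rw [Kernel.comp_apply, Measure.comp_eq_sum_of_countable, Measure.sum_fintype]

/-- The posterior of `P ∘ K` is the normalized image under `K` of the posterior of `P`. -/
theorem integral_posteriorLaw_precomp (P : Channel.{u} q) (K : Kernel (Fin q) (Fin q))
    [IsMarkovKernel K] {φ : (Fin q → ℝ) → ℝ} (hφ : Measurable φ) :
    ∫ p, φ p ∂((P.precomp K).posteriorLaw : Measure (stdSimplex ℝ (Fin q))) =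
      (q : ℝ)⁻¹ * ∫ p : stdSimplex ℝ (Fin q),
        perspective φ (fun i => ∑ j, (K i).real {j} * (q * (p : Fin q → ℝ) j))
        ∂(P.posteriorLaw : Measure _) := by
  have h0 : ∀ (y : P.Out) (i j : Fin q),
      0 ≤ (K i).real {j} * (q * (P.posteriorPoint y : Fin q → ℝ) j) := fun y i j => by
    have := (P.posteriorPoint y).2.1 j
    positivity
  have hdens : ∀ i, ∑ j, K i {j} • P.kernel j = P.marginal.withDensity fun y =>
      ENNReal.ofReal (∑ j, (K i).real {j} * (q * (P.posteriorPoint y : Fin q → ℝ) j)) := by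
    intro i
    ext E hE
    rw [withDensity_apply _ hE, Measure.finsetSum_apply]
    simp_rw [fun y => ENNReal.ofReal_sum_of_nonneg (fun j (_ : j ∈ Finset.univ) => h0 y i j)]
    rw [lintegral_finsetSum _ (fun j _ => by fun_prop)]
    refine Finset.sum_congr rfl fun j _ => ?_
    simp_rw [fun y => ENNReal.ofReal_mul (q := q * (P.posteriorPoint y : Fin q → ℝ) j)
      (measureReal_nonneg (μ := K i) (s := {j}))]
    rw [lintegral_const_mul _ (by fun_prop), Measure.smul_apply, kernel_eq_withDensity P j,
      withDensity_apply _ hE, ofReal_measureReal, smul_eq_mul]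
  rw [integral_posteriorLaw_of_withDensity (P.precomp K) (ρ := P.marginal)
    (g := fun y i => ∑ j, (K i).real {j} * (q * (P.posteriorPoint y : Fin q → ℝ) j)) ?_ ?_ ?_ hφ]
  · congr 1
    refine (integral_posteriorLaw P (φ := fun p => perspective φ
      (fun i => ∑ j, (K i).real {j} * (q * (p : Fin q → ℝ) j)))
        ((measurable_perspective hφ).comp ?_)).symm
    have h : ∀ j, Measurable fun p : stdSimplex ℝ (Fin q) => (p : Fin q → ℝ) j := fun j =>
      (measurable_pi_apply j).comp measurable_subtype_coe
    exact measurable_pi_lambda _ fun i => Finset.measurable_fun_sum _ fun j _ =>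
      ((h j).const_mul _).const_mul _
  · exact measurable_pi_lambda _ fun i => Finset.measurable_fun_sum _ fun j _ =>
      ((P.measurable_posteriorPoint_apply j).const_mul _).const_mul _
  · exact fun y i => Finset.sum_nonneg fun j _ => h0 y i j
  · exact fun i => (precomp_kernel_apply P K i).trans (hdens i)

theorem ConvergesWeakly.precomp {P : ℕ → Channel.{u} q} {P' : Channel.{v} q}
    (hP : ConvergesWeakly P P') (K : Kernel (Fin q) (Fin q)) [IsMarkovKernel K] :
    ConvergesWeakly (fun k => (P k).precomp K) (P'.precomp K) := by
  refine tendsto_of_tendsto_integral_expLin fun ℓ => ?_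
  simp_rw [integral_posteriorLaw_precomp _ K (continuous_expLin ℓ).measurable]
  refine Tendsto.const_mul _ (tendsto_integral_of_tendsto_probabilityMeasure hP ?_)
  refine (continuousOn_perspective (continuous_expLin ℓ)).comp_continuous ?_ ?_
  · have h : ∀ j, Continuous fun p : stdSimplex ℝ (Fin q) => (p : Fin q → ℝ) j := fun j =>
      (continuous_apply j).comp continuous_subtype_val
    exact continuous_pi fun i => continuous_finsetSum _ fun j _ =>
      ((h j).const_mul _).const_mul _
  · intro p i
    refine Finset.sum_nonneg fun j _ => ?_
    have := p.2.1 j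
    positivity

variable (β : Measure ℕ) [IsProbabilityMeasure β]

theorem mixture_kernel_apply {n : ℕ} (N : ℕ → Channel.{u} n) (i : Fin n) :
    (mixture β N).kernel i = β.bind fun b => ((N b).kernel i).map (Sigma.mk b) := rfl

theorem mixture_kernel_apply_apply {n : ℕ} (N : ℕ → Channel.{u} n) (i : Fin n)
    {E : Set (Σ b, (N b).Out)} (hE : MeasurableSet E) :
    (mixture β N).kernel i E = ∫⁻ b, (N b).kernel i ((fun y => ⟨b, y⟩) ⁻¹' E) ∂β := by
  refine (Measure.bind_apply hE Measurable.of_discrete.aemeasurable).trans ?_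
  exact lintegral_congr fun b => Measure.map_apply (measurable_sigmaMk b) hE

/-- The posterior law of a mixture is the mixture of the posterior laws. -/
theorem integral_posteriorLaw_mixture (N : ℕ → Channel.{u} q) {φ : (Fin q → ℝ) → ℝ}
    (hφ : Continuous φ) :
    ∫ p, φ p ∂((mixture β N).posteriorLaw : Measure (stdSimplex ℝ (Fin q))) =
      ∫ b, ∫ p, φ p ∂((N b).posteriorLaw : Measure (stdSimplex ℝ (Fin q))) ∂β := by
  have hq : (0 : ℝ) < q := by exact_mod_cast Nat.pos_of_ne_zero (NeZero.ne q)
  let κ : Kernel ℕ (Σ b, (N b).Out) :=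
    ⟨fun b => (N b).marginal.map (Sigma.mk b), Measurable.of_discrete⟩
  have hκ : ∀ b, κ b = (N b).marginal.map (Sigma.mk b) := fun _ => rfl
  have : IsMarkovKernel κ :=
    ⟨fun b => Measure.isProbabilityMeasure_map (measurable_sigmaMk b).aemeasurable⟩
  have hg : Measurable fun (y : Σ b, (N b).Out) (i : Fin q) =>
      (q : ℝ) * ((N y.1).posteriorPoint y.2 : Fin q → ℝ) i :=
    measurable_sigma_iff.2 fun b => measurable_pi_lambda _ fun i =>
      ((N b).measurable_posteriorPoint_apply i).const_mul _
  have hper : ∀ y : Σ b, (N b).Out, perspective φ (fun i : Fin q =>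
      (q : ℝ) * ((N y.1).posteriorPoint y.2 : Fin q → ℝ) i) =
      q * φ ((N y.1).posteriorPoint y.2) := fun y => by
    rw [← perspective_coe_stdSimplex φ, ← perspective_smul]
    rfl
  have hdens : ∀ i, (mixture β N).kernel i = (κ ∘ₘ β).withDensity fun y : Σ b, (N b).Out =>
      ENNReal.ofReal ((q : ℝ) * ((N y.1).posteriorPoint y.2 : Fin q → ℝ) i) := by
    intro i
    refine Measure.ext fun E hE => (mixture_kernel_apply_apply β N i hE).trans ?_
    have hgi : Measurable fun (y : Σ b, (N b).Out) =>
        ENNReal.ofReal ((q : ℝ) * ((N y.1).posteriorPoint y.2 : Fin q → ℝ) i) :=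
      ((measurable_pi_apply i).comp hg).ennreal_ofReal
    have hE' : MeasurableSet (α := Σ b, (N b).Out) E := hE
    refine Eq.trans ?_ (withDensity_apply _ hE').symm
    rw [← lintegral_indicator hE',
      Measure.lintegral_bind κ.aemeasurable (hgi.indicator hE').aemeasurable]
    refine lintegral_congr fun b => ?_
    rw [lintegral_indicator hE', hκ, setLIntegral_map hE' hgi (measurable_sigmaMk b),
      kernel_eq_withDensity, withDensity_apply _ (measurable_sigmaMk b hE')]
  refine (integral_posteriorLaw_of_withDensity (mixture β N) hg (fun y i => ?_) hdens
    hφ.measurable).trans ?_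
  · have := ((N y.1).posteriorPoint y.2).2.1 i
    positivity
  · change (q : ℝ)⁻¹ * ∫ y : Σ b, (N b).Out, _ ∂(κ ∘ₘ β) = _
    rw [integral_congr_ae (Eventually.of_forall hper), integral_const_mul,
      inv_mul_cancel_left₀ hq.ne']
    obtain ⟨C, hC⟩ := (isCompact_stdSimplex ℝ (Fin q)).exists_bound_of_continuousOn hφ.continuousOn
    have hm : Measurable fun y : Σ b, (N b).Out => φ ((N y.1).posteriorPoint y.2) :=
      measurable_sigma_iff.2 fun b => hφ.measurable.comp (N b).measurable_coe_posteriorPoint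
    rw [integral_measure_comp (Integrable.of_bound hm.aestronglyMeasurable C
      (Eventually.of_forall fun y => hC _ ((N y.1).posteriorPoint y.2).2))]
    refine integral_congr_ae (Eventually.of_forall fun b => ?_)
    simp only
    rw [hκ, integral_map (measurable_sigmaMk b).aemeasurable hm.aestronglyMeasurable]
    exact ((N b).integral_posteriorLaw (hφ.measurable.comp measurable_subtype_coe)).symm

theorem ConvergesWeakly.mixture {N : ℕ → ℕ → Channel.{u} q} {N' : ℕ → Channel.{v} q}
    (hN : ∀ b, ConvergesWeakly (fun k => N k b) (N' b)) :
    ConvergesWeakly (fun k => mixture β (N k)) (mixture β N') := by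
  refine tendsto_of_tendsto_integral_expLin fun ℓ => ?_
  simp_rw [integral_posteriorLaw_mixture β _ (continuous_expLin ℓ)]
  obtain ⟨C, hC⟩ := (isCompact_stdSimplex ℝ (Fin q)).exists_bound_of_continuousOn
    (continuous_expLin ℓ).continuousOn
  refine tendsto_integral_of_dominated_convergence (fun _ => C)
    (fun k => Measurable.of_discrete.aestronglyMeasurable) (integrable_const C)
    (fun k => Eventually.of_forall fun b => ?_)
    (Eventually.of_forall fun b => tendsto_integral_expLin (hN b) ℓ)
  refine (norm_integral_le_of_norm_le_const (C := C)
    (Eventually.of_forall fun p => hC _ p.2)).trans ?_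
  simp

theorem ConvergesWeakly.bp (T : TreeModel) (lam : ℝ)
    (hlam : lam ∈ Set.Icc (-1 / ((q : ℝ) - 1)) 1) {P : ℕ → Channel.{u} q} {P' : Channel.{u} q}
    (hP : ConvergesWeakly P P') :
    ConvergesWeakly (fun k => BP T lam hlam (P k)) (BP T lam hlam P') :=
  ConvergesWeakly.mixture _ fun b => (hP.precomp _).starPow b

end Channel

namespace Channel

/-! ### Degradation -/

section Degradation

variable {n : ℕ}

theorem Degradation.refl (P : Channel.{u} n) : P.Degradation P :=
  ⟨Kernel.id, inferInstance, (Kernel.id_comp _).symm⟩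

theorem Degradation.trans {P : Channel.{u} n} {Q : Channel.{v} n} {S : Channel.{w} n}
    (h : P.Degradation Q) (h' : Q.Degradation S) : P.Degradation S := by
  obtain ⟨R, hR, e⟩ := h
  obtain ⟨R', hR', e'⟩ := h'
  exact ⟨R ∘ₖ R', inferInstance, by rw [e, e', Kernel.comp_assoc]⟩

theorem Degradation.precomp {P : Channel.{u} n} {Q : Channel.{v} n} (h : P.Degradation Q)
    (K : Kernel (Fin n) (Fin n)) [IsMarkovKernel K] :
    (P.precomp K).Degradation (Q.precomp K) := by
  obtain ⟨R, hR, e⟩ := h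
  refine ⟨R, hR, ?_⟩
  change P.kernel ∘ₖ K = R ∘ₖ (Q.kernel ∘ₖ K)
  rw [e, Kernel.comp_assoc]

theorem Degradation.star {P P' : Channel.{u} n} {Q Q' : Channel.{v} n} (h : P.Degradation Q)
    (h' : P'.Degradation Q') : (P.star P').Degradation (Q.star Q') := by
  obtain ⟨R, hR, e⟩ := h
  obtain ⟨R', hR', e'⟩ := h'
  refine ⟨R ∥ₖ R', inferInstanceAs (IsMarkovKernel (R ∥ₖ R')), ?_⟩
  change P.kernel ×ₖ P'.kernel = (R ∥ₖ R') ∘ₖ (Q.kernel ×ₖ Q'.kernel)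
  rw [Kernel.parallelComp_comp_prod, e, e']

theorem Degradation.starPow {P : Channel.{u} n} {Q : Channel.{v} n} (h : P.Degradation Q)
    (b : ℕ) : (P.starPow b).Degradation (Q.starPow b) := by
  induction b with
  | zero =>
    refine ⟨Kernel.const PUnit (Measure.dirac PUnit.unit),
      inferInstanceAs (IsMarkovKernel (Kernel.const PUnit (Measure.dirac PUnit.unit))), ?_⟩
    change Kernel.const (Fin n) (Measure.dirac PUnit.unit) =
      Kernel.const PUnit (Measure.dirac PUnit.unit) ∘ₖ
        Kernel.const (Fin n) (Measure.dirac PUnit.unit)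
    ext i
    simp
  | succ b ih => exact ih.star h

theorem Degradation.mixture (β : Measure ℕ) [IsProbabilityMeasure β] {N : ℕ → Channel.{u} n}
    {N' : ℕ → Channel.{v} n} (h : ∀ b, (N b).Degradation (N' b)) :
    (mixture β N).Degradation (mixture β N') := by
  choose R hR e using h
  let S : Kernel (Σ b, (N' b).Out) (Σ b, (N b).Out) :=
    ⟨fun y => (R y.1 y.2).map (Sigma.mk y.1), measurable_sigma_iff.2 fun b =>
      (Measure.measurable_map _ (measurable_sigmaMk b)).comp (R b).measurable⟩
  have hS : ∀ b y, S ⟨b, y⟩ = (R b y).map (Sigma.mk b) := fun _ _ => rfl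
  refine ⟨S, ⟨fun y => Measure.isProbabilityMeasure_map (measurable_sigmaMk y.1).aemeasurable⟩,
    ?_⟩
  ext i E hE
  have hE' : MeasurableSet (α := Σ b, (N b).Out) E := hE
  refine (mixture_kernel_apply_apply β N i hE).trans ?_
  refine Eq.trans ?_ (Kernel.comp_apply' S (Channel.mixture β N').kernel i hE').symm
  refine Eq.trans ?_ (Measure.lintegral_bind
    (μ := fun b => ((N' b).kernel i).map (Sigma.mk b : _ → Σ b, (N' b).Out))
    Measurable.of_discrete.aemeasurable (S.measurable_coe hE').aemeasurable).symm
  refine lintegral_congr fun b => ?_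
  rw [lintegral_map (S.measurable_coe hE') (measurable_sigmaMk b), e b,
    Kernel.comp_apply' _ _ _ (measurable_sigmaMk b hE')]
  refine lintegral_congr fun y => ?_
  rw [hS, Measure.map_apply (measurable_sigmaMk b) hE']

theorem Degradation.bp [NeZero n] (T : TreeModel) (lam : ℝ)
    (hlam : lam ∈ Set.Icc (-1 / ((n : ℝ) - 1)) 1) {P : Channel.{u} n} {Q : Channel.{v} n}
    (h : P.Degradation Q) : (BP T lam hlam P).Degradation (BP T lam hlam Q) :=
  Degradation.mixture _ fun b => (h.precomp _).starPow b

theorem Degradation.kernel_eq {P : Channel.{u} n} {Q : Channel.{v} n} (h : P.Degradation Q)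
    {i j : Fin n} (hij : Q.kernel i = Q.kernel j) : P.kernel i = P.kernel j := by
  obtain ⟨R, -, e⟩ := h
  rw [e, Kernel.comp_apply, Kernel.comp_apply, hij]

theorem starPow_kernel_eq {P : Channel.{u} n} {i j : Fin n} (h : P.kernel i = P.kernel j)
    (b : ℕ) : (P.starPow b).kernel i = (P.starPow b).kernel j := by
  induction b with
  | zero => rfl
  | succ b ih =>
    change ((P.starPow b).star P).kernel i = ((P.starPow b).star P).kernel j
    rw [star_kernel_apply, star_kernel_apply, ih, h]

theorem bp_kernel_eq [NeZero n] (T : TreeModel) (lam : ℝ)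
    (hlam : lam ∈ Set.Icc (-1 / ((n : ℝ) - 1)) 1) {P : Channel.{u} n} {i j : Fin n}
    (h : (P.precomp (pottsKernel lam hlam)).kernel i =
      (P.precomp (pottsKernel lam hlam)).kernel j) :
    (BP T lam hlam P).kernel i = (BP T lam hlam P).kernel j := by
  change (mixture _ _).kernel i = (mixture _ _).kernel j
  rw [mixture_kernel_apply, mixture_kernel_apply]
  simp_rw [starPow_kernel_eq h]
  rfl

end Degradation

variable {q : ℕ} [NeZero q]

/-! ### Degradation of the indicator channel -/

theorem pottsKernel_apply_singleton (lam : ℝ) (hlam : lam ∈ Set.Icc (-1 / ((q : ℝ) - 1)) 1)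
    (i j : Fin q) : pottsKernel lam hlam i {j} =
      ENNReal.ofReal (lam * (if i = j then 1 else 0) + (1 - lam) / q) := by
  change (pottsPMF lam hlam i).toMeasure {j} = _
  rw [PMF.toMeasure_apply_singleton _ _ (measurableSet_singleton j)]
  rfl

theorem indicatorChannel_kernel_apply (i : Fin q) :
    (indicatorChannel q).kernel i = Measure.dirac (decide (i = 0)) :=
  Kernel.deterministic_apply (f := fun i : Fin q => decide (i = 0)) Measurable.of_discrete i

/-- The transposition of two letters `i, j ≠ 0` preserves the Potts channel and fixes `0`. -/
theorem precomp_indicatorChannel_kernel_eq (lam : ℝ)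
    (hlam : lam ∈ Set.Icc (-1 / ((q : ℝ) - 1)) 1) {i j : Fin q} (hi : i ≠ 0) (hj : j ≠ 0) :
    ((indicatorChannel q).precomp (pottsKernel lam hlam)).kernel i =
      ((indicatorChannel q).precomp (pottsKernel lam hlam)).kernel j := by
  rw [precomp_kernel_apply, precomp_kernel_apply]
  refine Fintype.sum_equiv (Equiv.swap i j) _ _ fun k => ?_
  have h1 : (j = Equiv.swap i j k) ↔ i = k := by
    rw [eq_comm, Equiv.swap_apply_eq_iff, Equiv.swap_apply_right, eq_comm]
  have h2 : Equiv.swap i j k = 0 ↔ k = 0 := by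
    rw [Equiv.swap_apply_eq_iff, Equiv.swap_apply_of_ne_of_ne hi.symm hj.symm]
  rw [pottsKernel_apply_singleton, pottsKernel_apply_singleton, indicatorChannel_kernel_apply,
    indicatorChannel_kernel_apply]
  simp only [h1, h2]
  rfl

theorem degradation_indicatorChannel {P : Channel.{u} q} {c : Fin q}
    (h : ∀ i, i ≠ 0 → P.kernel i = P.kernel c) : P.Degradation (indicatorChannel q) := by
  let R : Kernel Bool P.Out :=
    ⟨fun b => if b then P.kernel 0 else P.kernel c, Measurable.of_discrete⟩
  refine ⟨R, ⟨fun b => ?_⟩, ?_⟩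
  · cases b
    · exact inferInstanceAs (IsProbabilityMeasure (P.kernel c))
    · exact inferInstanceAs (IsProbabilityMeasure (P.kernel 0))
  · ext1 i
    have hi : (R ∘ₖ (indicatorChannel q).kernel) i = R (decide (i = 0)) := by
      refine (Kernel.comp_apply R (indicatorChannel q).kernel i).trans ?_
      exact (congrArg (fun m : Measure Bool => m.bind R) (indicatorChannel_kernel_apply i)).trans
        (Measure.dirac_bind R.measurable _)
    refine Eq.trans ?_ hi.symm
    change _ = if decide (i = 0) = true then P.kernel 0 else P.kernel c
    by_cases hi : i = 0
    · simp [hi]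
    · simp [hi, h i hi]

/-- Whether the letter after the Potts channel is `0` depends on the letter before it only through
whether that one is `0`, so a belief propagation step started from the indicator channel loses
information. -/
theorem degradation_bp_indicatorChannel (T : TreeModel) (lam : ℝ)
    (hlam : lam ∈ Set.Icc (-1 / ((q : ℝ) - 1)) 1) {c : Fin q} (hc : c ≠ 0) :
    (BP T lam hlam (indicatorChannel q)).Degradation (indicatorChannel q) :=
  degradation_indicatorChannel fun _ hi =>
    bp_kernel_eq T lam hlam (precomp_indicatorChannel_kernel_eq lam hlam hi hc)

/-! ### Data processing and the weak limit -/

theorem integrable_comp_posteriorPoint (P : Channel.{u} q) (m : Measure P.Out) [IsFiniteMeasure m]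
    {φ : (Fin q → ℝ) → ℝ} (hφ : Continuous φ) :
    Integrable (fun y => φ (P.posteriorPoint y)) m := by
  obtain ⟨C, hC⟩ := (isCompact_stdSimplex ℝ (Fin q)).exists_bound_of_continuousOn hφ.continuousOn
  exact Integrable.of_bound
    (hφ.measurable.comp P.measurable_coe_posteriorPoint).aestronglyMeasurable C
    (Eventually.of_forall fun y => hC _ (P.posteriorPoint y).2)

/-- Data processing: a degradation has a smaller expectation of a convex function of the posterior.
The tangent inequality `exp b * (1 + a - b) ≤ exp a` is integrated over the joint law of the two
outputs. -/
theorem Degradation.integral_expLin_le {P : Channel.{u} q} {Q : Channel.{v} q}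
    (h : P.Degradation Q) (ℓ : Fin q → ℝ) :
    ∫ p, expLin ℓ p ∂(P.posteriorLaw : Measure (stdSimplex ℝ (Fin q))) ≤
      ∫ p, expLin ℓ p ∂(Q.posteriorLaw : Measure (stdSimplex ℝ (Fin q))) := by
  have hq : (0 : ℝ) < q := by exact_mod_cast Nat.pos_of_ne_zero (NeZero.ne q)
  obtain ⟨R, hR, e⟩ := h
  have hm : P.marginal = R ∘ₘ Q.marginal := by
    rw [marginal, marginal, Measure.comp_assoc, e]
  set a : (Fin q → ℝ) → ℝ := fun p => ∑ i, ℓ i * p i with ha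
  have hac : Continuous a := by fun_prop
  have hexp : ∀ p, expLin ℓ p = Real.exp (a p) := fun p => rfl
  rw [integral_posteriorLaw P (φ := fun p => expLin ℓ p)
    ((continuous_expLin ℓ).measurable.comp measurable_subtype_coe),
    integral_posteriorLaw Q (φ := fun p => expLin ℓ p)
    ((continuous_expLin ℓ).measurable.comp measurable_subtype_coe)]
  set f : P.Out → ℝ := fun z => expLin ℓ (P.posteriorPoint z) with hf
  set g : P.Out → ℝ := fun z => expLin ℓ (P.posteriorPoint z) * (1 - a (P.posteriorPoint z))
    with hg
  have hφg : Continuous fun p => expLin ℓ p * (1 - a p) := by fun_prop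
  have hfi : ∀ (m : Measure P.Out) [IsFiniteMeasure m], Integrable f m := fun m _ =>
    P.integrable_comp_posteriorPoint m (continuous_expLin ℓ)
  have hgi : ∀ (m : Measure P.Out) [IsFiniteMeasure m], Integrable g m := fun m _ =>
    P.integrable_comp_posteriorPoint m hφg
  obtain ⟨C, hC⟩ := (isCompact_stdSimplex ℝ (Fin q)).exists_bound_of_continuousOn
    (continuous_expLin ℓ).continuousOn
  have hRf : StronglyMeasurable fun y : Q.Out => ∫ z, f z ∂(R y) :=
    ((continuous_expLin ℓ).measurable.comp
      P.measurable_coe_posteriorPoint).stronglyMeasurable.integral_kernel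
  have hRfC : ∀ y : Q.Out, ‖∫ z, f z ∂(R y)‖ ≤ C := fun y => by
    refine (norm_integral_le_of_norm_le_const (C := C)
      (Eventually.of_forall fun z => hC _ (P.posteriorPoint z).2)).trans ?_
    simp
  have hRg : Integrable (fun y : Q.Out => ∫ z, g z ∂(R y)) Q.marginal :=
    Integrable.integral_comp (κ := Kernel.const Unit Q.marginal) (a := ()) (by
      rw [← Measure.comp_eq_comp_const_apply]
      exact hgi _)
  have hterm : ∀ i, Integrable (fun y => (Q.posteriorPoint y : Fin q → ℝ) i * (∫ z, f z ∂(R y)))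
      Q.marginal := fun i =>
    (Q.integrable_comp_posteriorPoint Q.marginal (continuous_apply i)).mul_bdd
      hRf.aestronglyMeasurable (Eventually.of_forall hRfC)
  -- both sides are `q⁻¹ * ∫ f` over the output of `P` on the input `i`
  have h1 : ∀ i, ∫ z, (P.posteriorPoint z : Fin q → ℝ) i * f z ∂P.marginal =
      ∫ y, (Q.posteriorPoint y : Fin q → ℝ) i * (∫ z, f z ∂(R y)) ∂Q.marginal := by
    intro i
    have h2 := P.integral_kernel i f
    rw [e, Kernel.comp_apply, integral_measure_comp (hfi _), Q.integral_kernel] at h2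
    simp_rw [mul_assoc] at h2
    rw [integral_const_mul, integral_const_mul] at h2
    exact (mul_left_cancel₀ hq.ne' h2).symm
  have h3 : ∫ z, a (P.posteriorPoint z) * f z ∂P.marginal =
      ∫ y, a (Q.posteriorPoint y) * (∫ z, f z ∂(R y)) ∂Q.marginal := by
    simp only [ha, Finset.sum_mul, mul_assoc]
    rw [integral_finsetSum _ fun i _ => ?_, integral_finsetSum _ fun i _ => (hterm i).const_mul _]
    · simp_rw [integral_const_mul, h1]
    · exact (P.integrable_comp_posteriorPoint P.marginal
        (φ := fun p => p i * expLin ℓ p) (by fun_prop)).const_mul (ℓ i)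
  have hai : Integrable (fun y => a (Q.posteriorPoint y) * (∫ z, f z ∂(R y))) Q.marginal :=
    (Q.integrable_comp_posteriorPoint Q.marginal hac).mul_bdd
      hRf.aestronglyMeasurable (Eventually.of_forall hRfC)
  have h4 : ∫ z, f z ∂P.marginal =
      ∫ y, (∫ z, g z ∂(R y) + a (Q.posteriorPoint y) * (∫ z, f z ∂(R y))) ∂Q.marginal := by
    rw [integral_add hRg hai, ← h3, ← integral_measure_comp (by exact hgi _), ← hm,
      ← integral_add (hgi _) (P.integrable_comp_posteriorPoint P.marginal
        (φ := fun p => a p * expLin ℓ p) (by fun_prop))]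
    refine integral_congr_ae (Eventually.of_forall fun z => ?_)
    simp only [hf, hg]
    ring
  rw [h4]
  refine integral_mono (hRg.add hai)
    (Q.integrable_comp_posteriorPoint Q.marginal (continuous_expLin ℓ)) fun y => ?_
  simp only
  rw [← integral_const_mul, ← integral_add (hgi _) ((hfi _).const_mul _)]
  calc ∫ z, (g z + a (Q.posteriorPoint y) * f z) ∂(R y)
      ≤ ∫ _, expLin ℓ (Q.posteriorPoint y) ∂(R y) := by
        refine integral_mono ((hgi _).add ((hfi _).const_mul _)) (integrable_const _) fun z => ?_
        simp only [hf, hg, hexp]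
        set s := a (Q.posteriorPoint y)
        set t := a (P.posteriorPoint z)
        have h5 := Real.add_one_le_exp (s - t)
        have h6 : Real.exp s = Real.exp t * Real.exp (s - t) := by
          rw [← Real.exp_add]; congr 1; ring
        rw [h6]
        nlinarith [Real.exp_pos t]
    _ = expLin ℓ (Q.posteriorPoint y) := by simp

/-- A sequence of channels that get more and more degraded has a weak limit, in the sense that its
posterior laws converge. -/
theorem exists_tendsto_posteriorLaw {P : ℕ → Channel.{u} q}
    (h : ∀ k, (P (k + 1)).Degradation (P k)) :
    ∃ μ, Tendsto (fun k => (P k).posteriorLaw) atTop (𝓝 μ) := by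
  refine exists_tendsto_of_tendsto_integral_expLin fun ℓ => ?_
  have hanti : Antitone fun k =>
      ∫ p, expLin ℓ p ∂((P k).posteriorLaw : Measure (stdSimplex ℝ (Fin q))) :=
    antitone_nat_of_succ_le fun k => (h k).integral_expLin_le ℓ
  refine ⟨_, tendsto_atTop_ciInf hanti ⟨0, ?_⟩⟩
  rintro _ ⟨k, rfl⟩
  exact integral_nonneg fun p => (Real.exp_pos _).le

/-- The iterates `BP^k(U)` are decreasing in the degradation order. -/
theorem degradation_bp_iterate_succ (T : TreeModel) (lam : ℝ)
    (hlam : lam ∈ Set.Icc (-1 / ((q : ℝ) - 1)) 1) {c : Fin q} (hc : c ≠ 0) (k : ℕ) :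
    ((BP T lam hlam)^[k + 1] (indicatorChannel q)).Degradation
      ((BP T lam hlam)^[k] (indicatorChannel q)) := by
  induction k with
  | zero => exact degradation_bp_indicatorChannel T lam hlam hc
  | succ k ih =>
    rw [Function.iterate_succ_apply' _ (k + 1), Function.iterate_succ_apply' _ k] at *
    exact ih.bp T lam hlam

theorem degradation_bp_iterate (T : TreeModel) (lam : ℝ)
    (hlam : lam ∈ Set.Icc (-1 / ((q : ℝ) - 1)) 1) {c : Fin q} (hc : c ≠ 0) (k : ℕ) :
    ((BP T lam hlam)^[k] (indicatorChannel q)).Degradation (indicatorChannel q) := by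
  induction k with
  | zero => exact Degradation.refl _
  | succ k ih => exact (degradation_bp_iterate_succ T lam hlam hc k).trans ih

end Channel

/-! ### Moments of the offspring distributions -/

/-- The mean of the Poisson distribution, by the shift `(n + 1) * w (n + 1) = r * w n` of the
weights `w`. -/
theorem hasSum_poisson_mul_natCast (r : ℝ≥0) :
    HasSum (fun n : ℕ => Real.exp (-r) * r ^ n / n.factorial * (n : ℝ)) r := by
  rw [← hasSum_nat_add_iff' 1]
  have h := (hasSum_one_poissonMeasure r).mul_left (r : ℝ)
  simp only [Finset.range_one, Finset.sum_singleton, Nat.cast_zero, mul_zero, sub_zero]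
  rw [mul_one] at h
  refine h.congr_fun fun n => ?_
  have : (n.factorial : ℝ) ≠ 0 := by positivity
  rw [Nat.factorial_succ]
  push_cast
  field_simp
  ring

/-- The second factorial moment of the Poisson distribution. -/
theorem hasSum_poisson_mul_descFactorial (r : ℝ≥0) :
    HasSum (fun n : ℕ => Real.exp (-r) * r ^ n / n.factorial * ((n : ℝ) * (n - 1)))
      ((r : ℝ) ^ 2) := by
  rw [← hasSum_nat_add_iff' 1]
  have h := (hasSum_poisson_mul_natCast r).mul_left (r : ℝ)
  simp only [Finset.range_one, Finset.sum_singleton, Nat.cast_zero, zero_mul, mul_zero, sub_zero]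
  rw [← pow_two] at h
  refine h.congr_fun fun n => ?_
  have : (n.factorial : ℝ) ≠ 0 := by positivity
  rw [Nat.factorial_succ]
  push_cast
  field_simp
  ring

theorem natCast_mul_sub_one_nonneg (n : ℕ) : 0 ≤ (n : ℝ) * (n - 1) := by
  rcases Nat.eq_zero_or_pos n with rfl | h
  · simp
  · have : (1 : ℝ) ≤ n := by exact_mod_cast h
    exact mul_nonneg (by positivity) (by linarith)

namespace TreeModel

theorem integrable_natCast (T : TreeModel) :
    Integrable (fun b : ℕ => (b : ℝ)) T.offspringLaw := by
  cases T with
  | regular d => exact integrable_dirac (by simp)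
  | poisson d =>
    refine integrable_poissonMeasure_iff.2 ?_
    simpa using (hasSum_poisson_mul_natCast d).summable

theorem integral_natCast (T : TreeModel) :
    ∫ b : ℕ, (b : ℝ) ∂T.offspringLaw = T.meanOffspring := by
  cases T with
  | regular d => exact integral_dirac _ _
  | poisson d =>
    refine (integral_poissonMeasure d _).trans ?_
    exact (hasSum_poisson_mul_natCast d).tsum_eq

theorem integrable_natCast_mul_sub_one (T : TreeModel) :
    Integrable (fun b : ℕ => (b : ℝ) * (b - 1)) T.offspringLaw := by
  cases T with
  | regular d => exact integrable_dirac enorm_lt_top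
  | poisson d =>
    refine integrable_poissonMeasure_iff.2 ?_
    simp_rw [Real.norm_of_nonneg (natCast_mul_sub_one_nonneg _)]
    exact (hasSum_poisson_mul_descFactorial d).summable

theorem integral_natCast_mul_sub_one_le (T : TreeModel) :
    ∫ b : ℕ, (b : ℝ) * (b - 1) ∂T.offspringLaw ≤ T.meanOffspring ^ 2 := by
  cases T with
  | regular d =>
    refine (integral_dirac _ _).trans_le ?_
    simp only [meanOffspring]
    nlinarith [(Nat.cast_nonneg d : (0 : ℝ) ≤ d)]
  | poisson d =>
    refine ((integral_poissonMeasure d _).trans ?_).le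
    exact (hasSum_poisson_mul_descFactorial d).tsum_eq

end TreeModel

namespace Channel

/-! ### Second moments of linear estimators -/

variable {n : ℕ}

theorem integrable_of_integrable_sq {α : Type*} {mα : MeasurableSpace α} {m : Measure α}
    [IsFiniteMeasure m] {f : α → ℝ} (hf : Measurable f) (h : Integrable (fun x => f x ^ 2) m) :
    Integrable f m :=
  ((memLp_two_iff_integrable_sq hf.aestronglyMeasurable).2 h).integrable one_le_two

/-- The sum of the values of an estimator at the `b` outputs of a convolution power, which are
independent given the input, and its first two moments. -/
theorem exists_starPow_estimator (P : Channel.{u} n) {S : P.Out → ℝ} (hS : Measurable S)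
    (hi : ∀ i, Integrable (fun y => S y ^ 2) (P.kernel i)) (b : ℕ) :
    ∃ Sb : (P.starPow b).Out → ℝ, Measurable Sb ∧ ∀ i,
      Integrable (fun y => Sb y ^ 2) ((P.starPow b).kernel i) ∧
      ∫ y, Sb y ∂(P.starPow b).kernel i = b * ∫ y, S y ∂P.kernel i ∧
      ∫ y, Sb y ^ 2 ∂(P.starPow b).kernel i =
        b * ∫ y, S y ^ 2 ∂P.kernel i + b * (b - 1) * (∫ y, S y ∂P.kernel i) ^ 2 := by
  induction b with
  | zero => exact ⟨fun _ => 0, measurable_const, by simp⟩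
  | succ b ih =>
    obtain ⟨Sb, hSb, h⟩ := ih
    refine ⟨fun y : (P.starPow b).Out × P.Out => Sb y.1 + S y.2,
      (hSb.comp measurable_fst).add (hS.comp measurable_snd), fun i => ?_⟩
    obtain ⟨h1, h2, h3⟩ := h i
    have h4 := integrable_of_integrable_sq hSb h1
    have h5 := integrable_of_integrable_sq hS (hi i)
    have e : (P.starPow (b + 1)).kernel i = ((P.starPow b).kernel i).prod (P.kernel i) :=
      star_kernel_apply _ _ i
    have hsq : ∀ y : (P.starPow b).Out × P.Out, (Sb y.1 + S y.2) ^ 2 =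
        Sb y.1 ^ 2 + 2 * (Sb y.1 * S y.2) + S y.2 ^ 2 := fun y => by ring
    have i1 : Integrable (fun y : (P.starPow b).Out × P.Out => Sb y.1 ^ 2)
        (((P.starPow b).kernel i).prod (P.kernel i)) := h1.comp_fst _
    have i2 : Integrable (fun y : (P.starPow b).Out × P.Out => 2 * (Sb y.1 * S y.2))
        (((P.starPow b).kernel i).prod (P.kernel i)) := (h4.mul_prod h5).const_mul 2
    have i3 : Integrable (fun y : (P.starPow b).Out × P.Out => S y.2 ^ 2)
        (((P.starPow b).kernel i).prod (P.kernel i)) := (hi i).comp_snd _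
    have i4 : Integrable (fun y : (P.starPow b).Out × P.Out => Sb y.1)
        (((P.starPow b).kernel i).prod (P.kernel i)) := h4.comp_fst _
    have i5 : Integrable (fun y : (P.starPow b).Out × P.Out => S y.2)
        (((P.starPow b).kernel i).prod (P.kernel i)) := h5.comp_snd _
    have e1 : ∀ f : (P.starPow b).Out → ℝ, ∫ y : (P.starPow b).Out × P.Out, f y.1
        ∂(((P.starPow b).kernel i).prod (P.kernel i)) = ∫ y, f y ∂(P.starPow b).kernel i := by
      intro f
      simpa using integral_fun_fst (μ := (P.starPow b).kernel i) (ν := P.kernel i) f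
    have e2 : ∀ f : P.Out → ℝ, ∫ y : (P.starPow b).Out × P.Out, f y.2
        ∂(((P.starPow b).kernel i).prod (P.kernel i)) = ∫ y, f y ∂P.kernel i := by
      intro f
      simpa using integral_fun_snd (μ := (P.starPow b).kernel i) (ν := P.kernel i) f
    rw [e]
    refine ⟨((i1.add i2).add i3).congr (Eventually.of_forall fun y => (hsq y).symm), ?_, ?_⟩
    · refine (integral_add i4 i5).trans ?_
      rw [e1, e2, h2]
      push_cast
      ring
    · refine (integral_congr_ae (Eventually.of_forall hsq)).trans ?_
      refine (integral_add (i1.add i2) i3).trans ?_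
      rw [e2 fun y => S y ^ 2]
      refine (congrArg (· + _) (integral_add i1 i2)).trans ?_
      rw [e1 fun y => Sb y ^ 2, integral_const_mul, integral_prod_mul, h3, h2]
      push_cast
      ring

theorem integral_mixture (β : Measure ℕ) [IsProbabilityMeasure β] (N : ℕ → Channel.{u} n)
    (i : Fin n) {f : (Σ b, (N b).Out) → ℝ} (hf : Measurable f)
    (h : ∀ b, Integrable (fun y => f ⟨b, y⟩) ((N b).kernel i))
    (h' : Integrable (fun b => ∫ y, ‖f ⟨b, y⟩‖ ∂(N b).kernel i) β) :
    Integrable f ((mixture β N).kernel i) ∧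
      ∫ y, f y ∂(mixture β N).kernel i = ∫ b, ∫ y, f ⟨b, y⟩ ∂(N b).kernel i ∂β := by
  let κ : Kernel ℕ (Σ b, (N b).Out) :=
    ⟨fun b => ((N b).kernel i).map (Sigma.mk b), Measurable.of_discrete⟩
  have hκ : ∀ b, κ b = ((N b).kernel i).map (Sigma.mk b) := fun _ => rfl
  have : IsMarkovKernel κ :=
    ⟨fun b => Measure.isProbabilityMeasure_map (measurable_sigmaMk b).aemeasurable⟩
  have hmap : ∀ (g : (Σ b, (N b).Out) → ℝ) (_ : Measurable g) (b : ℕ),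
      ∫ y, g y ∂κ b = ∫ y, g ⟨b, y⟩ ∂(N b).kernel i := fun g hg b => by
    rw [hκ, integral_map (measurable_sigmaMk b).aemeasurable hg.aestronglyMeasurable]
  have hint : Integrable f (κ ∘ₘ β) := by
    refine (Measure.integrable_comp_iff hf.aestronglyMeasurable).2
      ⟨Eventually.of_forall fun b => ?_, ?_⟩
    · rw [hκ, integrable_map_measure hf.aestronglyMeasurable (measurable_sigmaMk b).aemeasurable]
      exact h b
    · simp_rw [hmap _ hf.norm]
      exact h'
  refine ⟨hint, (integral_measure_comp hint).trans ?_⟩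
  simp_rw [hmap _ hf]

variable {q : ℕ} [NeZero q]

/-- The centred indicator function of the letter `0`: an eigenvector of the Potts channel with
eigenvalue `λ`. -/
noncomputable def centredIndicator (q : ℕ) [NeZero q] (i : Fin q) : ℝ :=
  (if i = 0 then 1 else 0) - (q : ℝ)⁻¹

theorem centredIndicator_sq_le (i : Fin q) : centredIndicator q i ^ 2 ≤ 1 := by
  have hq : (1 : ℝ) ≤ q := by exact_mod_cast Nat.pos_of_ne_zero (NeZero.ne q)
  have h1 : (q : ℝ)⁻¹ ≤ 1 := inv_le_one_of_one_le₀ hq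
  have h2 : 0 ≤ (q : ℝ)⁻¹ := by positivity
  unfold centredIndicator
  split_ifs <;> nlinarith

theorem pottsKernel_real_singleton (lam : ℝ) (hlam : lam ∈ Set.Icc (-1 / ((q : ℝ) - 1)) 1)
    (i j : Fin q) : (pottsKernel lam hlam i).real {j} =
      lam * (if i = j then 1 else 0) + (1 - lam) / q := by
  rw [measureReal_def, pottsKernel_apply_singleton]
  refine ENNReal.toReal_ofReal ?_
  have hq : (1 : ℝ) ≤ q := by exact_mod_cast Nat.pos_of_ne_zero (NeZero.ne q)
  obtain ⟨h1, h2⟩ := hlam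
  have h3 : 0 ≤ (1 - lam) / q := div_nonneg (by linarith) (by linarith)
  split_ifs
  · have h4 : lam * 1 + (1 - lam) / q = (lam * (q - 1) + 1) / q := by
      field_simp
      ring
    rw [h4]
    refine div_nonneg ?_ (by linarith)
    rcases hq.eq_or_lt with h5 | h5
    · simp [← h5]
    · rw [div_le_iff₀ (by linarith)] at h1
      linarith
  · simpa using h3

theorem sum_pottsKernel_mul_centredIndicator (lam : ℝ)
    (hlam : lam ∈ Set.Icc (-1 / ((q : ℝ) - 1)) 1) (i : Fin q) :
    ∑ j, (pottsKernel lam hlam i).real {j} * centredIndicator q j =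
      lam * centredIndicator q i := by
  have hq : (q : ℝ) ≠ 0 := by exact_mod_cast NeZero.ne q
  have h0 : ∑ j, centredIndicator q j = 0 := by
    simp [centredIndicator, Finset.sum_sub_distrib, hq]
  simp_rw [pottsKernel_real_singleton, add_mul]
  rw [Finset.sum_add_distrib, ← Finset.mul_sum, h0]
  simp

/-- The channel has an unbiased estimator of the centred indicator of the letter `0` with second
moments at most `C`. -/
def HasEstimator (P : Channel.{u} q) (C : ℝ) : Prop :=
  ∃ S : P.Out → ℝ, Measurable S ∧ ∀ i, Integrable (fun y => S y ^ 2) (P.kernel i) ∧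
    ∫ y, S y ∂P.kernel i = centredIndicator q i ∧ ∫ y, S y ^ 2 ∂P.kernel i ≤ C

theorem hasEstimator_indicatorChannel {C : ℝ} (hC : 1 ≤ C) :
    (indicatorChannel q).HasEstimator C := by
  have hint : ∀ (f : Bool → ℝ) (i : Fin q),
      ∫ y, f y ∂(indicatorChannel q).kernel i = f (decide (i = 0)) := fun f i =>
    (congrArg (fun m : Measure Bool => ∫ y, f y ∂m) (indicatorChannel_kernel_apply i)).trans
      (integral_dirac f _)
  have hint' : ∀ (f : Bool → ℝ) (i : Fin q), Integrable f ((indicatorChannel q).kernel i) :=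
    fun f i => (congrArg (fun m : Measure Bool => Integrable f m)
      (indicatorChannel_kernel_apply i)).mpr (integrable_dirac enorm_lt_top)
  refine ⟨fun b : Bool => (if b then 1 else 0) - (q : ℝ)⁻¹, Measurable.of_discrete (α := Bool),
    fun i => ⟨hint' _ i, (hint _ i).trans ?_, (hint _ i).trans_le ?_⟩⟩
  · simp [centredIndicator]
  · simpa [centredIndicator] using (centredIndicator_sq_le i).trans hC

theorem integral_precomp (P : Channel.{u} n) (K : Kernel (Fin n) (Fin n)) [IsMarkovKernel K]
    (i : Fin n) {f : P.Out → ℝ} (hf : ∀ j, Integrable f (P.kernel j)) :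
    Integrable f ((P.precomp K).kernel i) ∧
      ∫ y, f y ∂(P.precomp K).kernel i = ∑ j, (K i).real {j} * ∫ y, f y ∂P.kernel j := by
  have h : ∀ j, Integrable f (K i {j} • P.kernel j) := fun j =>
    (hf j).smul_measure (measure_ne_top _ _)
  rw [precomp_kernel_apply]
  refine ⟨integrable_finsetSum_measure.2 fun j _ => h j,
    (integral_finsetSum_measure fun j _ => h j).trans ?_⟩
  simp_rw [integral_smul_measure]
  rfl

/-- The second moment recursion behind the Kesten–Stigum bound. Summing the estimator over the
children of a vertex and dividing by `d * λ` keeps it unbiased. The second moment is multiplied by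
`1 / (d * λ ^ 2)` and increases by at most `1`, so any bound `C ≥ 1 / (1 - 1 / (d * λ ^ 2))`
persists. -/
theorem HasEstimator.bp {T : TreeModel} {lam : ℝ} {hlam : lam ∈ Set.Icc (-1 / ((q : ℝ) - 1)) 1}
    {P : Channel.{u} q} {C : ℝ} (hKS : 1 < T.meanOffspring * lam ^ 2)
    (hC : C / (T.meanOffspring * lam ^ 2) + 1 ≤ C) (h : P.HasEstimator C) :
    (BP T lam hlam P).HasEstimator C := by
  obtain ⟨S, hS, h⟩ := h
  set d := T.meanOffspring with hd
  have hlam0 : lam ≠ 0 := by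
    rintro rfl
    norm_num at hKS
  have hd0 : 0 < d := by
    by_contra! hcon
    nlinarith [sq_nonneg lam]
  set P' := P.precomp (pottsKernel lam hlam) with hP'
  have hm1 : ∀ i, ∫ y, S y ∂P'.kernel i = lam * centredIndicator q i := fun i => by
    rw [(P.integral_precomp _ i fun j => integrable_of_integrable_sq hS (h j).1).2]
    simp_rw [fun j => (h j).2.1]
    exact sum_pottsKernel_mul_centredIndicator lam hlam i
  have hm2 : ∀ i, ∫ y, S y ^ 2 ∂P'.kernel i ≤ C := fun i => by
    rw [(P.integral_precomp _ i fun j => (h j).1).2]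
    calc _ ≤ ∑ j, (pottsKernel lam hlam i).real {j} * C :=
          Finset.sum_le_sum fun j _ => mul_le_mul_of_nonneg_left (h j).2.2 measureReal_nonneg
      _ = C := by rw [← Finset.sum_mul, sum_measureReal_singleton]; simp
  have hi2 : ∀ i, Integrable (fun y => S y ^ 2) (P'.kernel i) := fun i =>
    (P.integral_precomp _ i fun j => (h j).1).1
  choose Sb hSb hb using exists_starPow_estimator P' hS hi2
  have hmeas : Measurable fun y : Σ b, (P'.starPow b).Out => Sb y.1 y.2 :=
    measurable_sigma_iff.2 hSb
  refine ⟨fun y : Σ b, (P'.starPow b).Out => (d * lam)⁻¹ * Sb y.1 y.2, hmeas.const_mul _,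
    fun i => ?_⟩
  have hsq : Integrable (fun y : Σ b, (P'.starPow b).Out => Sb y.1 y.2 ^ 2)
        ((BP T lam hlam P).kernel i) ∧
      ∫ y : Σ b, (P'.starPow b).Out, Sb y.1 y.2 ^ 2 ∂(BP T lam hlam P).kernel i =
        ∫ b, ∫ y, Sb b y ^ 2 ∂(P'.starPow b).kernel i ∂T.offspringLaw := by
    refine integral_mixture T.offspringLaw (fun b => P'.starPow b) i (hmeas.pow_const 2)
      (fun b => (hb b i).1) ?_
    simp only [Real.norm_eq_abs, abs_pow, sq_abs, (hb _ i).2.2]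
    exact (T.integrable_natCast.mul_const _).add (T.integrable_natCast_mul_sub_one.mul_const _)
  have hbd : ∀ b : ℕ, ∫ y, Sb b y ^ 2 ∂(P'.starPow b).kernel i =
      b * ∫ y, S y ^ 2 ∂P'.kernel i + b * (b - 1) * (lam * centredIndicator q i) ^ 2 :=
    fun b => by rw [(hb b i).2.2, hm1]
  have hsq2 : ∫ y : Σ b, (P'.starPow b).Out, Sb y.1 y.2 ^ 2 ∂(BP T lam hlam P).kernel i ≤
      d * C + d ^ 2 * lam ^ 2 := by
    rw [hsq.2]
    simp_rw [hbd]
    rw [integral_add (T.integrable_natCast.mul_const _)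
      (T.integrable_natCast_mul_sub_one.mul_const _), integral_mul_const, integral_mul_const,
      T.integral_natCast]
    refine add_le_add (mul_le_mul_of_nonneg_left (hm2 i) hd0.le) ?_
    refine mul_le_mul T.integral_natCast_mul_sub_one_le ?_ (sq_nonneg _) (sq_nonneg _)
    rw [mul_pow]
    exact mul_le_of_le_one_right (sq_nonneg _) (centredIndicator_sq_le i)
  have hnorm : Integrable (fun b => ∫ y, ‖Sb b y‖ ∂(P'.starPow b).kernel i) T.offspringLaw := by
    have h2 : Integrable (fun b : ℕ => 1 + ∫ y, Sb b y ^ 2 ∂(P'.starPow b).kernel i)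
        T.offspringLaw := by
      simp_rw [hbd]
      exact (integrable_const _).add ((T.integrable_natCast.mul_const _).add
        (T.integrable_natCast_mul_sub_one.mul_const _))
    refine h2.mono' Measurable.of_discrete.aestronglyMeasurable
      (Eventually.of_forall fun b => ?_)
    have h3 := integrable_of_integrable_sq (hSb b) (hb b i).1
    rw [Real.norm_of_nonneg (integral_nonneg fun _ => norm_nonneg _)]
    calc ∫ y, ‖Sb b y‖ ∂(P'.starPow b).kernel i
        ≤ ∫ y, (1 + Sb b y ^ 2) ∂(P'.starPow b).kernel i := by
          refine integral_mono h3.norm ((integrable_const _).add (hb b i).1) fun y => ?_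
          simp only [Real.norm_eq_abs]
          nlinarith [sq_nonneg (|Sb b y| - 1), sq_abs (Sb b y), abs_nonneg (Sb b y)]
      _ = 1 + ∫ y, Sb b y ^ 2 ∂(P'.starPow b).kernel i := by
          rw [integral_add (integrable_const _) (hb b i).1]
          simp
  have hmean : ∫ y : Σ b, (P'.starPow b).Out, Sb y.1 y.2 ∂(BP T lam hlam P).kernel i =
      d * (lam * centredIndicator q i) := by
    refine (integral_mixture T.offspringLaw (fun b => P'.starPow b) i hmeas
      (fun b => integrable_of_integrable_sq (hSb b) (hb b i).1) hnorm).2.trans ?_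
    simp_rw [fun b => (hb b i).2.1, hm1]
    rw [integral_mul_const, T.integral_natCast]
  simp_rw [mul_pow]
  refine ⟨hsq.1.const_mul _, (integral_const_mul _ _).trans ?_,
    (integral_const_mul _ _).trans_le ?_⟩
  · refine (congrArg ((d * lam)⁻¹ * ·) hmean).trans ?_
    field_simp
  · refine le_trans (mul_le_mul_of_nonneg_left hsq2 (sq_nonneg _)) (le_trans (le_of_eq ?_) hC)
    field_simp

/-- By the Cauchy–Schwarz inequality, an estimator with bounded second moments keeps the posterior
probabilities of the letters `0` and `c ≠ 0` apart. -/
theorem HasEstimator.one_le {P : Channel.{u} q} {C : ℝ} (hC : 0 < C) (h : P.HasEstimator C)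
    {c : Fin q} (hc : c ≠ 0) :
    1 ≤ C * q ^ 2 * ∫ p, ((p : Fin q → ℝ) 0 - (p : Fin q → ℝ) c) ^ 2
      ∂(P.posteriorLaw : Measure (stdSimplex ℝ (Fin q))) := by
  have hq : (0 : ℝ) < q := by exact_mod_cast Nat.pos_of_ne_zero (NeZero.ne q)
  obtain ⟨S, hS, h⟩ := h
  have hφ : Continuous fun p : Fin q → ℝ => (p 0 - p c) ^ 2 := by fun_prop
  rw [integral_posteriorLaw P (φ := fun p => ((p : Fin q → ℝ) 0 - (p : Fin q → ℝ) c) ^ 2)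
    (hφ.measurable.comp measurable_subtype_coe)]
  set D : P.Out → ℝ := fun y => (P.posteriorPoint y : Fin q → ℝ) 0 - (P.posteriorPoint y) c
    with hD
  have hDi : Integrable (fun y => D y ^ 2) P.marginal :=
    P.integrable_comp_posteriorPoint _ hφ
  have hDm : Measurable D := by fun_prop
  have hS2 : Integrable (fun y => S y ^ 2) P.marginal := by
    rw [marginal_eq]
    exact (integrable_finsetSum_measure.2 fun i _ => (h i).1).smul_measure
      (ENNReal.inv_ne_top.2 (by exact_mod_cast NeZero.ne q))
  have hS2C : ∫ y, S y ^ 2 ∂P.marginal ≤ C := by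
    rw [marginal_eq, integral_smul_measure, integral_finsetSum_measure fun i _ => (h i).1]
    calc _ ≤ (q : ℝ≥0∞)⁻¹.toReal • ∑ _i : Fin q, C :=
          smul_le_smul_of_nonneg_left (Finset.sum_le_sum fun i _ => (h i).2.2)
            ENNReal.toReal_nonneg
      _ = C := by
          simp
          field_simp
  have hS1 := integrable_of_integrable_sq hS hS2
  have hpi : ∀ i, Integrable (fun y => q * (P.posteriorPoint y : Fin q → ℝ) i * S y)
      P.marginal := fun i => by
    refine hS1.bdd_mul (c := q) (by fun_prop) (Eventually.of_forall fun y => ?_)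
    have h0 := (P.posteriorPoint y).2.1 i
    have h1 := (mem_Icc_of_mem_stdSimplex (P.posteriorPoint y).2 i).2
    rw [Real.norm_of_nonneg (by positivity)]
    exact mul_le_of_le_one_right hq.le h1
  have hSD : ∫ y, S y * D y ∂P.marginal = (q : ℝ)⁻¹ := by
    have h1 : ∫ y, S y ∂P.kernel 0 - ∫ y, S y ∂P.kernel c = 1 := by
      rw [(h 0).2.1, (h c).2.1]
      simp [centredIndicator, hc]
    rw [integral_kernel, integral_kernel, ← integral_sub (hpi 0) (hpi c)] at h1
    rw [← mul_right_inj' hq.ne', ← integral_const_mul, mul_inv_cancel₀ hq.ne', ← h1]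
    refine integral_congr_ae (Eventually.of_forall fun y => ?_)
    simp only [hD]
    ring
  have hSDi : Integrable (fun y => S y * D y) P.marginal := by
    refine (((hpi 0).sub (hpi c)).const_mul (q : ℝ)⁻¹).congr (Eventually.of_forall fun y => ?_)
    simp only [hD, Pi.sub_apply]
    field_simp
  -- expand the integral of `(S - t * D) ^ 2` at `t = C * q`
  have hexp : 0 ≤ ∫ y, (S y - C * q * D y) ^ 2 ∂P.marginal :=
    integral_nonneg fun y => sq_nonneg _
  have hexp2 : ∫ y, (S y - C * q * D y) ^ 2 ∂P.marginal =
      ∫ y, S y ^ 2 ∂P.marginal - 2 * (C * q) * ∫ y, S y * D y ∂P.marginal +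
        (C * q) ^ 2 * ∫ y, D y ^ 2 ∂P.marginal := by
    have hring : ∀ y, (S y - C * q * D y) ^ 2 =
        S y ^ 2 - 2 * (C * q) * (S y * D y) + (C * q) ^ 2 * D y ^ 2 := fun y => by ring
    refine (integral_congr_ae (Eventually.of_forall hring)).trans ((integral_add
      (hS2.sub (hSDi.const_mul _)) (hDi.const_mul _)).trans ?_)
    refine (congrArg (· + _) (integral_sub hS2 (hSDi.const_mul _))).trans ?_
    rw [integral_const_mul, integral_const_mul]
  rw [hexp2, hSD] at hexp
  have h2 : 2 * (C * q) * (q : ℝ)⁻¹ = 2 * C := by field_simp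
  rw [h2] at hexp
  have h3 : 0 ≤ C * (C * q ^ 2 * ∫ y, D y ^ 2 ∂P.marginal - 1) := by nlinarith
  have h4 := nonneg_of_mul_nonneg_right h3 hC
  linarith

end Channel

/-! ### Standard Borel output alphabets -/

/-- The measurable structure of a countable disjoint union of Borel spaces is the Borel structure of
the disjoint union topology: a measurable set is the countable union of its traces on the
summands. -/
theorem measurableSpace_sigma_eq_borel {ι : Type*} [Countable ι] {α : ι → Type*}
    [∀ b, TopologicalSpace (α b)] [∀ b, MeasurableSpace (α b)] [∀ b, BorelSpace (α b)] :
    (Sigma.instMeasurableSpace : MeasurableSpace (Σ b, α b)) = borel (Σ b, α b) := by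
  refine le_antisymm (fun s hs => ?_) ?_
  · have hU : s = ⋃ b, s ∩ Set.range (Sigma.mk b) := by
      ext ⟨b, y⟩
      simp
    rw [hU]
    refine @MeasurableSet.iUnion _ _ (borel (Σ b, α b)) _ _ fun b => ?_
    have hcomap : (borel (Σ b, α b)).comap (Sigma.mk b) = ‹∀ b, MeasurableSpace (α b)› b := by
      rw [← borel_comap, ← Topology.IsEmbedding.sigmaMk.isInducing.eq_induced,
        ← BorelSpace.measurable_eq]
    have h1 : MeasurableSet[(borel (Σ b, α b)).comap (Sigma.mk b)] (Sigma.mk b ⁻¹' s) := by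
      rw [hcomap]
      exact measurableSet_sigma_iff.1 hs b
    obtain ⟨t, ht, hts⟩ := h1
    have h2 : s ∩ Set.range (Sigma.mk b) = t ∩ Set.range (Sigma.mk b) := by
      rw [← Set.image_preimage_eq_inter_range, ← hts, Set.image_preimage_eq_inter_range]
    rw [h2]
    exact @MeasurableSet.inter _ (borel (Σ b, α b)) _ _ ht
      (MeasurableSpace.measurableSet_generateFrom isOpen_range_sigmaMk)
  · refine MeasurableSpace.generateFrom_le fun s hs => measurableSet_sigma_iff.2 fun b => ?_
    exact (hs.preimage continuous_sigmaMk).measurableSet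

instance standardBorelSpace_sigma {ι : Type*} [Countable ι] {α : ι → Type*}
    [∀ b, MeasurableSpace (α b)] [∀ b, StandardBorelSpace (α b)] :
    StandardBorelSpace (Σ b, α b) := by
  choose t ht hp using fun b => StandardBorelSpace.polish (α := α b)
  exact ⟨⟨inferInstance, ⟨measurableSpace_sigma_eq_borel⟩, inferInstance⟩⟩

namespace Channel

theorem standardBorelSpace_starPow {n : ℕ} (P : Channel.{u} n) [StandardBorelSpace P.Out]
    (b : ℕ) : StandardBorelSpace (P.starPow b).Out := by
  induction b with
  | zero => exact inferInstanceAs (StandardBorelSpace PUnit)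
  | succ b ih => exact inferInstanceAs (StandardBorelSpace ((P.starPow b).Out × P.Out))

variable {q : ℕ} [NeZero q]

theorem standardBorelSpace_bp (T : TreeModel) (lam : ℝ)
    (hlam : lam ∈ Set.Icc (-1 / ((q : ℝ) - 1)) 1) (P : Channel.{u} q) [StandardBorelSpace P.Out] :
    StandardBorelSpace (BP T lam hlam P).Out := by
  have : StandardBorelSpace (P.precomp (pottsKernel lam hlam)).Out :=
    inferInstanceAs (StandardBorelSpace P.Out)
  have := standardBorelSpace_starPow (P.precomp (pottsKernel lam hlam))
  exact inferInstanceAs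
    (StandardBorelSpace (Σ b, ((P.precomp (pottsKernel lam hlam)).starPow b).Out))

/-! ### Channels with the same posterior law -/

@[fun_prop]
theorem measurable_coe_stdSimplex_apply {n : ℕ} (i : Fin n) :
    Measurable fun p : stdSimplex ℝ (Fin n) => (p : Fin n → ℝ) i :=
  (measurable_pi_apply i).comp measurable_subtype_coe

theorem map_posteriorPoint_kernel (P : Channel.{u} q) (i : Fin q) :
    (P.kernel i).map P.posteriorPoint =
      (P.posteriorLaw : Measure (stdSimplex ℝ (Fin q))).withDensity
        fun p => ENNReal.ofReal (q * (p : Fin q → ℝ) i) := by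
  ext E hE
  rw [Measure.map_apply P.measurable_posteriorPoint hE, withDensity_apply _ hE,
    posteriorLaw_eq_map, setLIntegral_map hE (by fun_prop) P.measurable_posteriorPoint,
    kernel_eq_withDensity, withDensity_apply _ (P.measurable_posteriorPoint hE)]

/-- The posterior is a sufficient statistic: the output of the channel can be resampled from it,
with the conditional law of the output given the posterior. -/
theorem degradation_of_posteriorLaw_eq (P : Channel.{u} q) (Q : Channel.{v} q)
    [StandardBorelSpace P.Out] (h : P.posteriorLaw = Q.posteriorLaw) : P.Degradation Q := by
  have hne : Nonempty P.Out := nonempty_of_isProbabilityMeasure (P.kernel 0)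
  set R := condDistrib id P.posteriorPoint P.marginal with hR
  have hcomp := compProd_map_condDistrib (mβ := inferInstance) (X := P.posteriorPoint) (Y := id)
    (μ := P.marginal) aemeasurable_id
  rw [← hR] at hcomp
  refine ⟨R ∘ₖ Kernel.deterministic Q.posteriorPoint Q.measurable_posteriorPoint, inferInstance,
    ?_⟩
  ext i E hE
  have hd : Measurable fun p : stdSimplex ℝ (Fin q) =>
      ENNReal.ofReal (q * (p : Fin q → ℝ) i) := by fun_prop
  rw [Kernel.comp_assoc, Kernel.comp_apply, Kernel.comp_apply, Measure.deterministic_comp_eq_map,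
    map_posteriorPoint_kernel, ← h, Measure.bind_apply hE R.aemeasurable,
    lintegral_withDensity_eq_lintegral_mul _ hd (R.measurable_coe hE), posteriorLaw_eq_map]
  have h1 : ∀ p, ((fun p : stdSimplex ℝ (Fin q) => ENNReal.ofReal (q * (p : Fin q → ℝ) i)) *
      fun p => R p E) p =
      ∫⁻ y, ENNReal.ofReal (q * (p : Fin q → ℝ) i) * E.indicator 1 y ∂(R p) := fun p => by
    rw [lintegral_const_mul _ (measurable_one.indicator hE), lintegral_indicator_one hE]
    rfl
  have h2 : Measurable fun z : stdSimplex ℝ (Fin q) × P.Out =>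
      ENNReal.ofReal (q * (z.1 : Fin q → ℝ) i) * E.indicator 1 z.2 :=
    (hd.comp measurable_fst).mul ((measurable_one.indicator hE).comp measurable_snd)
  rw [lintegral_congr h1, ← Measure.lintegral_compProd h2, hcomp,
    lintegral_map h2 (P.measurable_posteriorPoint.prodMk measurable_id),
    kernel_eq_withDensity, withDensity_apply _ hE, ← lintegral_indicator hE]
  refine lintegral_congr fun y => ?_
  by_cases hy : y ∈ E <;> simp [hy]

theorem integral_posteriorPoint_apply (P : Channel.{u} q) (i : Fin q) :
    ∫ p, (p : Fin q → ℝ) i ∂(P.posteriorLaw : Measure (stdSimplex ℝ (Fin q))) = (q : ℝ)⁻¹ := by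
  have hq : (q : ℝ) ≠ 0 := by exact_mod_cast NeZero.ne q
  rw [integral_posteriorLaw P (φ := fun p => (p : Fin q → ℝ) i) (by fun_prop)]
  have h := P.integral_kernel i fun _ => 1
  simp only [integral_const, probReal_univ, smul_eq_mul, mul_one] at h
  rw [integral_const_mul] at h
  field_simp
  linarith

/-- Whether the channel distinguishes `i` from `j` is read off its posterior law, through a
quantity that is weakly continuous. -/
theorem kernel_eq_iff_integral_eq_zero (P : Channel.{u} q) (i j : Fin q) :
    P.kernel i = P.kernel j ↔
      ∫ p, ((p : Fin q → ℝ) i - (p : Fin q → ℝ) j) ^ 2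
        ∂(P.posteriorLaw : Measure (stdSimplex ℝ (Fin q))) = 0 := by
  have hq : (q : ℝ) ≠ 0 := by exact_mod_cast NeZero.ne q
  rw [integral_posteriorLaw P (φ := fun p => ((p : Fin q → ℝ) i - (p : Fin q → ℝ) j) ^ 2)
    (by fun_prop)]
  set D : (Fin q → ℝ) → ℝ := fun p => p i - p j with hD
  have hi : ∀ φ : (Fin q → ℝ) → ℝ, Continuous φ →
      Integrable (fun y => φ (P.posteriorPoint y)) P.marginal :=
    fun φ hφ => P.integrable_comp_posteriorPoint P.marginal hφ
  constructor
  · intro h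
    have h1 : ∫ y, D (P.posteriorPoint y) ∂P.kernel i = ∫ y, D (P.posteriorPoint y) ∂P.kernel j :=
      by rw [h]
    rw [integral_kernel, integral_kernel, ← sub_eq_zero, ← integral_sub
      (hi (fun p => q * p i * D p) (by fun_prop)) (hi (fun p => q * p j * D p) (by fun_prop))] at h1
    rw [← mul_right_inj' hq, mul_zero, ← integral_const_mul, ← h1]
    refine integral_congr_ae (Eventually.of_forall fun y => ?_)
    simp only [hD]
    ring
  · intro h
    rw [integral_eq_zero_iff_of_nonneg (fun y => sq_nonneg _)
      (hi (fun p => D p ^ 2) (by fun_prop))] at h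
    rw [kernel_eq_withDensity, kernel_eq_withDensity]
    refine withDensity_congr_ae (h.mono fun y hy => ?_)
    have : (P.posteriorPoint y : Fin q → ℝ) i = (P.posteriorPoint y : Fin q → ℝ) j :=
      sub_eq_zero.1 (pow_eq_zero_iff two_ne_zero |>.1 hy)
    simp only [this]

/-! ### The channel with a given posterior law -/

theorem lintegral_ofReal_mul_eq_one {μ : ProbabilityMeasure (stdSimplex ℝ (Fin q))} {i : Fin q}
    (h : ∫ p, (p : Fin q → ℝ) i ∂(μ : Measure (stdSimplex ℝ (Fin q))) = (q : ℝ)⁻¹) :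
    ∫⁻ p, ENNReal.ofReal (q * (p : Fin q → ℝ) i) ∂(μ : Measure (stdSimplex ℝ (Fin q))) = 1 := by
  have hq : (q : ℝ) ≠ 0 := by exact_mod_cast NeZero.ne q
  rw [← ofReal_integral_eq_lintegral_ofReal, integral_const_mul, h, mul_inv_cancel₀ hq,
    ENNReal.ofReal_one]
  · refine Integrable.of_bound
      ((measurable_coe_stdSimplex_apply i).const_mul _).aestronglyMeasurable q
      (Eventually.of_forall fun p => ?_)
    have h0 := p.2.1 i
    rw [Real.norm_of_nonneg (by positivity)]
    exact mul_le_of_le_one_right (by positivity) (mem_Icc_of_mem_stdSimplex p.2 i).2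
  · refine Eventually.of_forall fun p => ?_
    have h0 := p.2.1 i
    simp only [Pi.zero_apply]
    positivity

/-- The channel whose output is its own posterior, with posterior law `μ`. The barycentre of `μ`
has to be the uniform distribution. -/
noncomputable def ofPosteriorLaw (μ : ProbabilityMeasure (stdSimplex ℝ (Fin q)))
    (h : ∀ i, ∫ p, (p : Fin q → ℝ) i ∂(μ : Measure (stdSimplex ℝ (Fin q))) = (q : ℝ)⁻¹) :
    Channel.{0} q where
  Out := stdSimplex ℝ (Fin q)
  kernel := ⟨fun i => (μ : Measure (stdSimplex ℝ (Fin q))).withDensity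
    fun p => ENNReal.ofReal (q * (p : Fin q → ℝ) i), Measurable.of_discrete⟩
  isMarkovKernel := ⟨fun i => ⟨by
    change ((μ : Measure (stdSimplex ℝ (Fin q))).withDensity _) _ = 1
    rw [withDensity_apply _ MeasurableSet.univ, setLIntegral_univ]
    exact lintegral_ofReal_mul_eq_one (h i)⟩⟩

theorem posteriorLaw_ofPosteriorLaw (μ : ProbabilityMeasure (stdSimplex ℝ (Fin q)))
    (h : ∀ i, ∫ p, (p : Fin q → ℝ) i ∂(μ : Measure (stdSimplex ℝ (Fin q))) = (q : ℝ)⁻¹) :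
    (ofPosteriorLaw μ h).posteriorLaw = μ := by
  have hq : (q : ℝ) ≠ 0 := by exact_mod_cast NeZero.ne q
  have he : ((ofPosteriorLaw μ h).posteriorLaw : Measure (stdSimplex ℝ (Fin q))) = μ := by
    refine ext_of_integral_expLin fun ℓ => ?_
    refine (integral_posteriorLaw_of_withDensity (ofPosteriorLaw μ h)
      (ρ := (μ : Measure (stdSimplex ℝ (Fin q))))
      (g := fun (p : stdSimplex ℝ (Fin q)) i => q * (p : Fin q → ℝ) i)
      (measurable_pi_lambda _ fun i => (measurable_coe_stdSimplex_apply i).const_mul _)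
      (fun p i => mul_nonneg (Nat.cast_nonneg q) (p.2.1 i)) (fun i => rfl)
      (continuous_expLin ℓ).measurable).trans ?_
    have hper : ∀ p : stdSimplex ℝ (Fin q), perspective (expLin ℓ)
        (fun i => q * (p : Fin q → ℝ) i) = q * expLin ℓ p := fun p => by
      rw [← perspective_coe_stdSimplex (expLin ℓ), ← perspective_smul]
      rfl
    refine (congrArg ((q : ℝ)⁻¹ * ·) ((integral_congr_ae (Eventually.of_forall hper)).trans
      (integral_const_mul _ _))).trans ?_
    exact inv_mul_cancel_left₀ hq _
  exact Subtype.ext he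

/-! ### Symmetric channels -/

/-- By double transitivity of the symmetric group, a fully memoryless symmetric channel that does
not distinguish some two letters distinguishes none. -/
theorem IsFMS.isTrivial {n : ℕ} {Q : Channel.{u} n} (hQ : Q.IsFMS) {a b : Fin n} (hab : a ≠ b)
    (h : Q.kernel a = Q.kernel b) : Q.IsTrivial := by
  obtain ⟨ι, hι, hsymm⟩ := hQ
  intro i j
  rcases eq_or_ne i j with rfl | hij
  · rfl
  -- a permutation with `τ a = i` and `τ b = j`
  set τ : Equiv.Perm (Fin n) := Equiv.swap (Equiv.swap a i b) j * Equiv.swap a i with hτ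
  have hτb : τ b = j := by simp [hτ]
  have hτa : τ a = i := by
    have h1 : i ≠ Equiv.swap a i b := fun hi => hab (by
      rw [eq_comm, Equiv.swap_apply_eq_iff, Equiv.swap_apply_right] at hi
      exact hi.symm)
    simp only [hτ, Equiv.Perm.mul_apply, Equiv.swap_apply_left]
    exact Equiv.swap_apply_of_ne_of_ne h1 hij
  ext E hE
  have h1 := hsymm τ a _ (hι τ hE)
  have h2 := hsymm τ b _ (hι τ hE)
  rw [Equiv.image_preimage, hτa] at h1
  rw [Equiv.image_preimage, hτb] at h2
  rw [← h1, ← h2, h]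

theorem Degradation.isTrivial {n : ℕ} {P : Channel.{u} n} {Q : Channel.{v} n}
    (h : P.Degradation Q) (hQ : Q.IsTrivial) : P.IsTrivial :=
  fun i j => h.kernel_eq (hQ i j)

end Channel

theorem mainTheorem12 (q : ℕ) [NeZero q] (hq : 3 ≤ q) (T : TreeModel) (lam : ℝ)
    (hlam : lam ∈ Set.Icc (-1 / ((q : ℝ) - 1)) 1) (hKS : 1 < T.meanOffspring * lam ^ 2) :
    ∃ M : Channel.{0} q,
      Channel.ConvergesWeakly
          (fun k => (BP T lam hlam)^[k] (Channel.indicatorChannel q)) M ∧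
        Channel.Equivalent (BP T lam hlam M) M ∧
        ¬ M.IsTrivial ∧
        ∀ Q : Channel.{v} q, Q.IsFMS → ¬ Channel.Equivalent M Q := by
  set P : ℕ → Channel.{0} q := fun k => (BP T lam hlam)^[k] (Channel.indicatorChannel q) with hP
  have hsucc : ∀ k, P (k + 1) = BP T lam hlam (P k) := fun k => Function.iterate_succ_apply' _ _ _
  let a : Fin q := ⟨1, by omega⟩
  let b : Fin q := ⟨2, by omega⟩
  have ha : a ≠ 0 := fun h => by simpa [a] using congrArg Fin.val h
  have hb : b ≠ 0 := fun h => by simpa [b] using congrArg Fin.val h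
  have hab : a ≠ b := fun h => by simpa [a, b] using congrArg Fin.val h
  obtain ⟨μ, hμ⟩ := Channel.exists_tendsto_posteriorLaw (P := P)
    (Channel.degradation_bp_iterate_succ T lam hlam ha)
  have hcont : ∀ i : Fin q, Continuous fun p : stdSimplex ℝ (Fin q) => (p : Fin q → ℝ) i :=
    fun i => (continuous_apply i).comp continuous_subtype_val
  have hbary : ∀ i, ∫ p, (p : Fin q → ℝ) i ∂(μ : Measure (stdSimplex ℝ (Fin q))) =
      (q : ℝ)⁻¹ := fun i => by
    refine tendsto_nhds_unique (tendsto_integral_of_tendsto_probabilityMeasure hμ (hcont i)) ?_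
    simp_rw [Channel.integral_posteriorPoint_apply]
    exact tendsto_const_nhds
  set M := Channel.ofPosteriorLaw μ hbary with hM
  have hMμ : M.posteriorLaw = μ := Channel.posteriorLaw_ofPosteriorLaw μ hbary
  have hconv : Channel.ConvergesWeakly P M := by
    rw [Channel.ConvergesWeakly, hMμ]
    exact hμ
  have hfix : (BP T lam hlam M).posteriorLaw = M.posteriorLaw := by
    have h1 := hconv.bp T lam hlam
    rw [Channel.ConvergesWeakly] at h1
    simp_rw [← hsucc] at h1
    exact tendsto_nhds_unique h1 (hconv.comp (tendsto_add_atTop_nat 1))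
  have hMab : M.kernel a = M.kernel b := by
    rw [Channel.kernel_eq_iff_integral_eq_zero]
    refine tendsto_nhds_unique (tendsto_integral_of_tendsto_probabilityMeasure hconv
      (((hcont a).sub (hcont b)).pow 2)) ?_
    have h0 : ∀ k, (P k).kernel a = (P k).kernel b := fun k =>
      (Channel.degradation_bp_iterate T lam hlam ha k).kernel_eq (by
        rw [Channel.indicatorChannel_kernel_apply, Channel.indicatorChannel_kernel_apply]
        simp [ha, hb]
        rfl)
    simp_rw [fun k => ((P k).kernel_eq_iff_integral_eq_zero a b).1 (h0 k)]
    exact tendsto_const_nhds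
  have hMtriv : ¬ M.IsTrivial := by
    intro htriv
    set D := T.meanOffspring * lam ^ 2 with hD
    have hD1 : 0 < D - 1 := by linarith
    -- the fixed point of `C ↦ C / D + 1`
    set C := D / (D - 1) with hC
    have hC1 : 1 ≤ C := by rw [hC, le_div_iff₀ hD1]; linarith
    have hC2 : C / D + 1 ≤ C := le_of_eq (by
      rw [hC]
      field_simp
      ring)
    have hest : ∀ k, (P k).HasEstimator C := fun k => by
      induction k with
      | zero => exact Channel.hasEstimator_indicatorChannel hC1
      | succ k ih =>
        rw [hsucc]
        exact ih.bp hKS hC2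
    have h1 : 1 ≤ C * q ^ 2 * ∫ p, ((p : Fin q → ℝ) 0 - (p : Fin q → ℝ) a) ^ 2
        ∂(M.posteriorLaw : Measure (stdSimplex ℝ (Fin q))) :=
      ge_of_tendsto' ((tendsto_integral_of_tendsto_probabilityMeasure hconv
        (((hcont 0).sub (hcont a)).pow 2)).const_mul (C * q ^ 2))
      fun k => (hest k).one_le (by linarith) ha
    rw [(M.kernel_eq_iff_integral_eq_zero 0 a).1 (htriv 0 a)] at h1
    norm_num at h1
  have hMsb : StandardBorelSpace M.Out :=
    inferInstanceAs (StandardBorelSpace (stdSimplex ℝ (Fin q)))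
  have hBPsb := Channel.standardBorelSpace_bp T lam hlam M
  refine ⟨M, hconv, ⟨Channel.degradation_of_posteriorLaw_eq _ _ hfix,
    Channel.degradation_of_posteriorLaw_eq _ _ hfix.symm⟩, hMtriv, fun Q hQ hMQ => ?_⟩
  exact hMtriv (hMQ.1.isTrivial (hQ.isTrivial hab (hMQ.2.kernel_eq hMab)))
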